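/- Fix the alphabet $\Sigma=\{0,1\}$. For a nondeterministic polynomial-time Turing machine $N$ let $\mathrm{acc}_N(x)$ be the number of accepting computation paths of $N$ on input $x\in\Sigma^*$. Let $\mathrm{FP}$ be the class of (total) functions computable in deterministic polynomial time; integers are written in binary, and $\langle x,i\rangle$ denotes a standard polynomial-time computable and invertible pairing of strings $x\in\Sigma^*$ with natural numbers $i$ written in binary. The class $\mathrm{C}_{=}\mathrm{P}$ consists of all $A\subseteq\Sigma^*$ for which there are a nondeterministic polynomial-time Turing machine $N$ and a function $f\in\mathrm{FP}$ with values in $\mathbb{Z}$ such that for every $x\in\Sigma^*$: $x\in A \iff \mathrm{acc}_N(x)=f(x)$. For $r:\mathbb{N}\to\mathbb{N}$, the class $r\text{-}\mathrm{C}_{=}\mathrm{P}$ consists of all $A\subseteq\Sigma^*$ for which there are a nondeterministic polynomial-time Turing machine $N$ and a function $f\in\mathrm{FP}$ with values in $\mathbb{Z}$ such that for every $x\in\Sigma^*$: $x\in A$ if and only if there is an $i\in\{1,2,\dots,r(|x|)\}$ with $\mathrm{acc}_N(x)=f(\langle x,i\rangle)$. Put $$\mathrm{Poly}\text{-}\mathrm{C}_{=}\mathrm{P}=\bigcup_{c\ge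 1}\,(n^c+c)\text{-}\mathrm{C}_{=}\mathrm{P}.$$ Theorem. $\mathrm{Poly}\text{-}\mathrm{C}_{=}\mathrm{P}=\mathrm{C}_{=}\mathrm{P}$. -/

import Mathlib

namespace ExactCounting

open Computability

/-- The binary encoding of the integers: a sign bit (`true` for negative integers), followed by the
binary expansion of the absolute value, least significant bit first. -/
def encodingInt : Encoding ℤ Bool where
  encode z := decide (z < 0) :: encodeNat z.natAbs
  decode l := match l with
    | [] => none
    | s :: l => some (if s then -(decodeNat l : ℤ) else (decodeNat l : ℤ))
  decode_encode z := by
    rcases lt_or_ge z 0 with h | h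
    · simp [h, abs_of_neg h]
    · simp [not_lt.mpr h, abs_of_nonneg h]

/-- The pairing `⟨x, i⟩` of a binary string `x` and a number `i` (written in binary): the two words
are put one after the other, over two disjoint copies of the alphabet. -/
def encodingPair : Encoding (List Bool × ℕ) (Bool ⊕ Bool) :=
  encodingProd (encodingList Bool) encodingNatBool

/-- `InFP e f`: the integer-valued function `f`, on a domain whose elements are presented by the
encoding `e`, is computable in polynomial time by a deterministic (multi-stack) Turing machine. -/
def InFP {α Γ : Type} (e : Encoding α Γ) (f : α → ℤ) : Prop :=
  Nonempty (Turing.TM2ComputableInPolyTime e.encode encodingInt.encode f)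

/-- A nondeterministic Turing machine with input alphabet `{0, 1}`, over Mathlib's deterministic
(multi-stack) Turing machines. When the machine is at the label `l` it executes either the
statement `m l` or, if there is one, the alternative statement `alt l`; so a step offers one or two
choices. A halting computation accepts if it ends in an internal state with `accept v = true`.

As in `Turing.FinTM2`, labels, internal states, stacks and input alphabet are finite; the other
stacks carry only the finitely many symbols that the program can push. The output stack `k₁` plays
no role here. -/
structure NTM extends Turing.FinTM2 where
  /-- the input alphabet is `{0, 1}` -/
  inputAlphabet : Γ k₀ ≃ Bool
  /-- the second choice at a label, if there is one -/
  alt : Λ → Option (Turing.TM2.Stmt Γ Λ σ)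
  /-- the accepting internal states -/
  accept : σ → Bool

namespace NTM

variable (M : NTM)

/-- The start configuration on input `x`: the word `x` is on the input stack, the other stacks are
empty. -/
def init (x : List Bool) : M.toFinTM2.Cfg :=
  Turing.initList M.toFinTM2 (x.map M.inputAlphabet.symm)

/-- One step under the choice `b`; `none` if the machine has halted, or if `b` is the second choice
and the current label has no alternative statement. -/
def step (b : Bool) (c : M.toFinTM2.Cfg) : Option M.toFinTM2.Cfg :=
  match c.l with
  | none => none
  | some l =>
    match b with
    | false => some (Turing.TM2.stepAux (M.m l) c.var c.stk)
    | true => (M.alt l).map fun s => Turing.TM2.stepAux s c.var c.stk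

/-- The configuration reached from `c` along the sequence of choices `w`, one for each step; `none`
if `w` is not a (partial) computation path from `c`. -/
def run : M.toFinTM2.Cfg → List Bool → Option M.toFinTM2.Cfg
  | c, [] => some c
  | c, b :: w => (M.step b c).bind fun c' => run c' w

/-- The accepting computation paths of `M` on input `x`, each given by its sequence of choices
(a step that offers just one choice is always recorded as `false`). -/
def acceptingPaths (x : List Bool) : Set (List Bool) :=
  {w | ∃ c, M.run (M.init x) w = some c ∧ c.l = none ∧ M.accept c.var = true}

/-- `acc_M(x)`, the number of accepting computation paths of `M` on input `x`. -/
noncomputable def acc (x : List Bool) : ℕ :=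
  (M.acceptingPaths x).ncard

/-- `M` is polynomial-time: for some polynomial `p`, on every input `x`, every (partial)
computation path has at most `p(|x|)` steps. -/
def IsPolyTime : Prop :=
  ∃ p : Polynomial ℕ, ∀ x w : List Bool,
    (M.run (M.init x) w).isSome = true → w.length ≤ p.eval x.length

/-- A polynomial-time machine has finitely many accepting paths on each input, so that `acc` is
their true number. -/
theorem IsPolyTime.finite_acceptingPaths {M : NTM} (h : M.IsPolyTime) (x : List Bool) :
    (M.acceptingPaths x).Finite := by
  obtain ⟨p, hp⟩ := h
  refine (List.finite_length_le Bool (p.eval x.length)).subset ?_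
  rintro w ⟨c, hc, -⟩
  exact hp x w (by rw [hc]; rfl)

end NTM

/-- The class `C₌P`. -/
def CeqP : Set (Language Bool) :=
  {A | ∃ N : NTM, N.IsPolyTime ∧ ∃ f : List Bool → ℤ, InFP (encodingList Bool) f ∧
    ∀ x : List Bool, x ∈ A ↔ (N.acc x : ℤ) = f x}

/-- The class `r-C₌P`, with `r(|x|)` target values, indexed by `1, …, r(|x|)`. -/
def IndexedCeqP (r : ℕ → ℕ) : Set (Language Bool) :=
  {A | ∃ N : NTM, N.IsPolyTime ∧ ∃ f : List Bool × ℕ → ℤ, InFP encodingPair f ∧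
    ∀ x : List Bool, x ∈ A ↔ ∃ i ∈ Finset.Icc 1 (r x.length), (N.acc x : ℤ) = f (x, i)}

/-- The class `Poly-C₌P`, the union of the classes `(n ^ c + c)-C₌P` over all positive `c`. -/
def PolyCeqP : Set (Language Bool) :=
  ⋃ c : ℕ+, IndexedCeqP fun n => n ^ (c : ℕ) + (c : ℕ)

end ExactCounting

/-! The nontrivial inclusion is a disjunction turned into a product. An input lies in the language
iff the product over `j` of the differences `acc_N(x) - f(x, j)` vanishes. Such a product can be
realised as a signed path count. A machine carries a sign through its computation; if it ends with
sign plus on `p'` paths and sign minus on `m'` paths, then running a second stage after a first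
multiplies both `p' - m'` and `p' + m'`. If the total `p' + m'` is a known power of two, the signed
count is zero iff exactly half of all paths end with sign plus. That is a single target value, and
it is easy to compute.

One stage starts with a coin flip. On one side `N` runs with exactly `m` binary choices, and the
sign changes unless the choices describe an accepting path; the signed count is `2 acc - 2^m`. On
the other side `f(x, j)` is computed and an `m`-bit number is guessed, and the sign changes when the
guess is smaller than the value; the signed count is `2^m - 2 f(x, j)`. Both sides have `2^m` paths,
so the stage has `2^(m+1)` paths and signed count `2 (acc - f(x, j))`. Negative values, and values
with more than `m` bits, are replaced by `2^m`. This is harmless because `m` exceeds the length of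
every path, which gives `acc < 2^m` (`card_paths_advN_lt`, `eq_threshold_iff`).

With `R` stages the machine has `2^((m+1)R)` paths, and membership means that exactly `2^((m+1)R -
1)` of them accept (`outcomes_signStep`, `exists_sem_round`, `exists_sem_product`,
`indexedCeqP_subset`). The converse inclusion uses a target function that ignores the index
(`InFP.comp_fst`).

Most of the work is to build this as an actual multi-stack machine. Programs are written in a small
structured language, and `Sem` records the multiset of final states together with a time bound.
`Sem.acc_eq` and `Sem.outputs` transfer this to path counts of nondeterministic machines and to
outputs of deterministic ones. The given machines for `N` and `f` are embedded statement by
statement (`exec_lift`). After every use their stacks are emptied, so that all paths of a stage end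
in one of two states, distinguished only by the sign. -/

namespace ExactCounting

open Turing TM2

/-! ### Structured programs and their computation trees -/

section Programs

variable {K : Type} {Γ : K → Type} {σ Λ Λ' : Type}

/-- The statement that jumps to a label, or halts. -/
def jump : Option Λ → Stmt Γ Λ σ
  | none => .halt
  | some l => .goto fun _ => l

/-- Redirect all exits of a statement to the same target. -/
def exitTo (l : Option Λ') : Stmt Γ Λ σ → Stmt Γ Λ' σ
  | .push k f q => .push k f (exitTo l q)
  | .peek k f q => .peek k f (exitTo l q)
  | .pop k f q => .pop k f (exitTo l q)
  | .load f q => .load f (exitTo l q)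
  | .branch f q₁ q₂ => .branch f (exitTo l q₁) (exitTo l q₂)
  | .goto _ => jump l
  | .halt => jump l

/-- Structured nondeterministic programs over a family of stacks. -/
inductive Prog {K : Type} (Γ : K → Type) (σ : Type) : Type
  | basic : Stmt Γ Unit σ → Prog Γ σ
  | seq : Prog Γ σ → Prog Γ σ → Prog Γ σ
  | loop : (σ → Bool) → Prog Γ σ → Prog Γ σ
  | flip : Prog Γ σ → Prog Γ σ → Prog Γ σ

namespace Prog

/-- The control points of a program. -/
def Lab : Prog Γ σ → Type
  | basic _ => Unit
  | seq P Q => P.Lab ⊕ Q.Lab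
  | loop _ P => Option P.Lab
  | flip P Q => Option (P.Lab ⊕ Q.Lab)

instance instFintypeLab : (P : Prog Γ σ) → Fintype P.Lab
  | basic _ => inferInstanceAs (Fintype Unit)
  | seq P Q =>
    letI := instFintypeLab P
    letI := instFintypeLab Q
    inferInstanceAs (Fintype (P.Lab ⊕ Q.Lab))
  | loop _ P =>
    letI := instFintypeLab P
    inferInstanceAs (Fintype (Option P.Lab))
  | flip P Q =>
    letI := instFintypeLab P
    letI := instFintypeLab Q
    inferInstanceAs (Fintype (Option (P.Lab ⊕ Q.Lab)))

/-- The control point at which a program starts. -/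
def entry : (P : Prog Γ σ) → P.Lab
  | basic _ => ()
  | seq P _ => Sum.inl P.entry
  | loop _ _ => none
  | flip _ _ => none

/-- The first statement and the alternative statement at each control point, where control points
are embedded into the labels of an ambient machine and the program is left to `x`. -/
def code : (P : Prog Γ σ) → (P.Lab → Λ) → Option Λ → P.Lab →
    Stmt Γ Λ σ × Option (Stmt Γ Λ σ)
  | basic s, _, x, _ => (exitTo x s, none)
  | seq P Q, e, x, l =>
    match l with
    | Sum.inl l => code P (fun l => e (Sum.inl l)) (some (e (Sum.inr Q.entry))) l
    | Sum.inr l => code Q (fun l => e (Sum.inr l)) x l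
  | loop b P, e, x, l =>
    match l with
    | none => (.branch b (jump (some (e (some P.entry)))) (jump x), none)
    | some l => code P (fun l => e (some l)) (some (e none)) l
  | flip P Q, e, x, l =>
    match l with
    | none => (jump (some (e (some (Sum.inl P.entry)))),
        some (jump (some (e (some (Sum.inr Q.entry))))))
    | some (Sum.inl l) => code P (fun l => e (some (Sum.inl l))) x l
    | some (Sum.inr l) => code Q (fun l => e (some (Sum.inr l))) x l

end Prog

variable [DecidableEq K]

/-- The effect of a statement on the internal state and the stacks. -/
def exec (s : Stmt Γ Λ σ) (x : σ × ∀ k, List (Γ k)) : σ × ∀ k, List (Γ k) :=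
  ((stepAux s x.1 x.2).var, (stepAux s x.1 x.2).stk)

@[simp] theorem stepAux_jump (l : Option Λ) (v : σ) (S : ∀ k, List (Γ k)) :
    stepAux (jump l) v S = ⟨l, v, S⟩ := by
  cases l <;> rfl

theorem stepAux_exitTo (l : Option Λ') (s : Stmt Γ Λ σ) (v : σ) (S : ∀ k, List (Γ k)) :
    stepAux (exitTo l s) v S = ⟨l, (exec s (v, S)).1, (exec s (v, S)).2⟩ := by
  induction s generalizing v S with
  | push k f q ih => simpa [exitTo, exec] using ih _ _
  | peek k f q ih => simpa [exitTo, exec] using ih _ _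
  | pop k f q ih => simpa [exitTo, exec] using ih _ _
  | load f q ih => simpa [exitTo, exec] using ih _ _
  | branch f q₁ q₂ ih₁ ih₂ =>
    cases h : f v
    · simpa [exitTo, exec, h] using ih₂ v S
    · simpa [exitTo, exec, h] using ih₁ v S
  | goto f => simp [exitTo, exec]
  | halt => simp [exitTo, exec]

/-- `Unfolds code c t O`: the computation tree of the configuration `c`, cut off at suitable nodes
of depth at most `t`, has the leaves `O`. -/
inductive Unfolds (code : Λ → Stmt Γ Λ σ × Option (Stmt Γ Λ σ)) :
    Cfg Γ Λ σ → ℕ → Multiset (Cfg Γ Λ σ) → Prop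
  | leaf (c t) : Unfolds code c t {c}
  | single {l v S t O} : (code l).2 = none → Unfolds code (stepAux (code l).1 v S) t O →
      Unfolds code ⟨some l, v, S⟩ (t + 1) O
  | double {l v S t O O' s} : (code l).2 = some s → Unfolds code (stepAux (code l).1 v S) t O →
      Unfolds code (stepAux s v S) t O' → Unfolds code ⟨some l, v, S⟩ (t + 1) (O + O')

namespace Unfolds

variable {code : Λ → Stmt Γ Λ σ × Option (Stmt Γ Λ σ)} {c : Cfg Γ Λ σ} {t t' : ℕ}
  {O : Multiset (Cfg Γ Λ σ)}

theorem mono (h : Unfolds code c t O) (htt : t ≤ t') : Unfolds code c t' O := by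
  induction h generalizing t' with
  | leaf c t => exact leaf c t'
  | single h₁ _ ih =>
    obtain ⟨u, rfl⟩ : ∃ u, t' = u + 1 := ⟨t' - 1, by omega⟩
    exact single h₁ (ih (by omega))
  | double h₁ _ _ ih₁ ih₂ =>
    obtain ⟨u, rfl⟩ : ∃ u, t' = u + 1 := ⟨t' - 1, by omega⟩
    exact double h₁ (ih₁ (by omega)) (ih₂ (by omega))

theorem card_pos (h : Unfolds code c t O) : 0 < O.card := by
  induction h with
  | leaf => simp
  | single _ _ ih => exact ih
  | double _ _ _ ih₁ ih₂ => rw [Multiset.card_add]; omega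

/-- An unfolding with a single leaf is a deterministic computation. -/
theorem evalsTo {d : Cfg Γ Λ σ} (h : Unfolds code c t {d}) :
    ∃ n ≤ t, (_root_.flip Bind.bind (TM2.step fun l => (code l).1))^[n] (some c) = some d := by
  generalize hO : ({d} : Multiset (Cfg Γ Λ σ)) = O at h
  induction h with
  | leaf c t => exact ⟨0, by omega, by simpa using (Multiset.singleton_inj.1 hO).symm⟩
  | single h₁ _ ih =>
    obtain ⟨n, hn, h⟩ := ih hO
    exact ⟨n + 1, by omega, by rw [Function.iterate_succ_apply]; exact h⟩
  | double h₁ h₂ h₃ ih₁ ih₂ =>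
    -- Both subtrees have at least one leaf, so a branching node cannot have just one leaf in total.
    have := congrArg Multiset.card hO
    have := h₂.card_pos
    have := h₃.card_pos
    simp at *
    omega

end Unfolds

/-- `Sem enc P x t O`: started in the state `x`, each computation path of the program `P` ends after
at most `t` steps, and `O` lists the final states of all paths. Here `enc` tells how the abstract
states are represented by the internal state and the stacks. -/
inductive Sem {X : Type} (enc : X → σ × ∀ k, List (Γ k)) :
    Prog Γ σ → X → ℕ → Multiset X → Prop
  | basic {s x y} : exec s (enc x) = enc y → Sem enc (.basic s) x 1 {y}
  | seq {P Q x t t' O O'} : Sem enc P x t O → (∀ y ∈ O, Sem enc Q y t' (O' y)) →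
      Sem enc (.seq P Q) x (t + t') (O.bind O')
  | done {b P x} : b (enc x).1 = false → Sem enc (.loop b P) x 1 {x}
  | again {b P x t t' O O'} : b (enc x).1 = true → Sem enc P x t O →
      (∀ y ∈ O, Sem enc (.loop b P) y t' (O' y)) →
      Sem enc (.loop b P) x (t + t' + 1) (O.bind O')
  | flip {P Q x t O O'} : Sem enc P x t O → Sem enc Q x t O' →
      Sem enc (.flip P Q) x (t + 1) (O + O')
  | mono {P x t t' O} : Sem enc P x t O → t ≤ t' → Sem enc P x t' O

namespace Sem

variable {X : Type} {enc : X → σ × ∀ k, List (Γ k)} {P Q : Prog Γ σ} {x y z : X} {t t' : ℕ}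
  {O : Multiset X}

/-- The continuation `U` after the exit `r` is arbitrary. This is what makes the induction work: the
exit of the first part of a sequence is the entry of the second, and the exit of a loop body is the
loop test. -/
theorem unfolds_bind (h : Sem enc P x t O) {cd : Λ → Stmt Γ Λ σ × Option (Stmt Γ Λ σ)}
    (e : P.Lab → Λ) (r : Option Λ) (he : ∀ l, cd (e l) = P.code e r l)
    {U : X → Multiset (Cfg Γ Λ σ)} {u : ℕ}
    (hU : ∀ y ∈ O, Unfolds cd ⟨r, (enc y).1, (enc y).2⟩ u (U y)) :
    Unfolds cd ⟨some (e P.entry), (enc x).1, (enc x).2⟩ (t + u) (O.bind U) := by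
  induction h generalizing r U u with
  | @basic s x y h =>
    rw [Nat.add_comm, Multiset.singleton_bind]
    refine .single (by rw [he]; rfl) ?_
    rw [he]
    simp only [Prog.code, stepAux_exitTo, Prod.mk.eta, h]
    exact hU y (by simp)
  | @seq P Q x t t' O O' _ _ ih₁ ih₂ =>
    rw [Multiset.bind_assoc, Nat.add_assoc]
    refine ih₁ (fun l => e (Sum.inl l)) (some (e (Sum.inr Q.entry))) (fun l => he (Sum.inl l))
      fun y hy => ih₂ y hy (fun l => e (Sum.inr l)) r (fun l => he (Sum.inr l)) fun z hz => ?_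
    exact hU z (Multiset.mem_bind.2 ⟨y, hy, hz⟩)
  | @done b P x hb =>
    rw [Nat.add_comm, Multiset.singleton_bind]
    refine .single (by rw [he]; rfl) ?_
    rw [he]
    simp only [Prog.code, Prog.entry, stepAux, hb, cond_false, stepAux_jump]
    exact hU x (by simp)
  | @again b P x t t' O O' hb _ _ ih₁ ih₂ =>
    rw [Multiset.bind_assoc, show t + t' + 1 + u = t + (t' + u) + 1 by omega]
    refine .single (by rw [he]; rfl) ?_
    rw [he]
    simp only [Prog.code, Prog.entry, stepAux, hb, cond_true, stepAux_jump]
    refine ih₁ (fun l => e (some l)) (some (e none)) (fun l => he (some l))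
      fun y hy => ih₂ y hy e r he fun z hz => ?_
    exact hU z (Multiset.mem_bind.2 ⟨y, hy, hz⟩)
  | @flip P Q x t O O' _ _ ih₁ ih₂ =>
    rw [Multiset.add_bind, Nat.add_right_comm]
    refine .double (by rw [he]; rfl) ?_ ?_
    · rw [he]
      simpa [Prog.code, Prog.entry] using ih₁ (fun l => e (some (Sum.inl l))) r
        (fun l => he (some (Sum.inl l))) fun z hz => hU z (by simp [hz])
    · simpa using ih₂ (fun l => e (some (Sum.inr l))) r
        (fun l => he (some (Sum.inr l))) fun z hz => hU z (by simp [hz])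
  | mono _ h ih => exact (ih e r he hU).mono (by omega)

theorem unfolds (h : Sem enc P x t O) :
    Unfolds (P.code id none) ⟨some P.entry, (enc x).1, (enc x).2⟩ t
      (O.map fun y => ⟨none, (enc y).1, (enc y).2⟩) := by
  have := h.unfolds_bind (cd := P.code id none) id none (fun _ => rfl)
    (U := fun y => {⟨none, (enc y).1, (enc y).2⟩}) (u := 0) fun y _ => .leaf _ _
  rwa [Multiset.bind_singleton] at this

/-! Rules for programs with a single path, and for sequences in which one part has this property. -/

theorem seq_left {O : Multiset X} (h : Sem enc P x t {y}) (h' : Sem enc Q y t' O) :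
    Sem enc (.seq P Q) x (t + t') O := by
  simpa using h.seq (O' := fun _ => O) (t' := t') fun z hz => by
    rw [Multiset.mem_singleton.1 hz]; exact h'

theorem seq_right {O : Multiset X} {g : X → X} (h : Sem enc P x t O)
    (h' : ∀ y ∈ O, Sem enc Q y t' {g y}) : Sem enc (.seq P Q) x (t + t') (O.map g) := by
  have := h.seq h'
  rwa [Multiset.bind_singleton] at this

theorem again_left {b : σ → Bool} {O : Multiset X} (hb : b (enc x).1 = true)
    (h : Sem enc P x t {y}) (h' : Sem enc (.loop b P) y t' O) :
    Sem enc (.loop b P) x (t + t' + 1) O := by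
  simpa using h.again hb (O' := fun _ => O) (t' := t') fun z hz => by
    rw [Multiset.mem_singleton.1 hz]; exact h'

end Sem

/-- One step of a nondeterministic computation under the choice `b`. -/
def chooseStep (code : Λ → Stmt Γ Λ σ × Option (Stmt Γ Λ σ)) (b : Bool) (c : Cfg Γ Λ σ) :
    Option (Cfg Γ Λ σ) :=
  match c.l with
  | none => none
  | some l =>
    match b with
    | false => some (stepAux (code l).1 c.var c.stk)
    | true => (code l).2.map fun s => stepAux s c.var c.stk

/-- The configuration reached along a sequence of choices. -/
def chooseRun (code : Λ → Stmt Γ Λ σ × Option (Stmt Γ Λ σ)) :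
    Cfg Γ Λ σ → List Bool → Option (Cfg Γ Λ σ)
  | c, [] => some c
  | c, b :: w => (chooseStep code b c).bind fun c' => chooseRun code c' w

/-- The accepting computation paths from a configuration. -/
def acceptingFrom (code : Λ → Stmt Γ Λ σ × Option (Stmt Γ Λ σ)) (accept : σ → Bool)
    (c : Cfg Γ Λ σ) : Set (List Bool) :=
  {w | ∃ d, chooseRun code c w = some d ∧ d.l = none ∧ accept d.var = true}

/-! ### Counting accepting paths along a computation tree -/

section Accepting

variable {code : Λ → Stmt Γ Λ σ × Option (Stmt Γ Λ σ)} {accept : σ → Bool} {c d : Cfg Γ Λ σ}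

theorem nil_mem_acceptingFrom :
    [] ∈ acceptingFrom code accept c ↔ c.l = none ∧ accept c.var = true := by
  simp [acceptingFrom, chooseRun]

theorem cons_mem_acceptingFrom {b : Bool} {w : List Bool} :
    b :: w ∈ acceptingFrom code accept c ↔
      ∃ d, chooseStep code b c = some d ∧ w ∈ acceptingFrom code accept d := by
  simp only [acceptingFrom, chooseRun, Set.mem_ofPred_eq, Option.bind_eq_some_iff]
  constructor
  · rintro ⟨d, ⟨e, h₁, h₂⟩, h₃⟩; exact ⟨e, h₁, d, h₂, h₃⟩
  · rintro ⟨e, h₁, d, h₂, h₃⟩; exact ⟨d, ⟨e, h₁, h₂⟩, h₃⟩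

theorem acceptingFrom_halted (hc : c.l = none) :
    acceptingFrom code accept c = if accept c.var = true then {[]} else ∅ := by
  ext w
  cases w with
  | nil => rw [nil_mem_acceptingFrom]; split_ifs <;> simp [*]
  | cons b w => rw [cons_mem_acceptingFrom]; simp only [chooseStep, hc]; split_ifs <;> simp

theorem acceptingFrom_single (hc : c.l ≠ none) (hd : chooseStep code false c = some d)
    (hd' : chooseStep code true c = none) :
    acceptingFrom code accept c = List.cons false '' acceptingFrom code accept d := by
  ext w
  cases w with
  | nil => rw [nil_mem_acceptingFrom]; simp [hc]
  | cons b w => rw [cons_mem_acceptingFrom]; cases b <;> simp [hd, hd']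

theorem acceptingFrom_double {e : Cfg Γ Λ σ} (hc : c.l ≠ none)
    (hd : chooseStep code false c = some d) (he : chooseStep code true c = some e) :
    acceptingFrom code accept c = List.cons false '' acceptingFrom code accept d ∪
      List.cons true '' acceptingFrom code accept e := by
  ext w
  cases w with
  | nil => rw [nil_mem_acceptingFrom]; simp [hc]
  | cons b w => rw [cons_mem_acceptingFrom]; cases b <;> simp [hd, he]

theorem ncard_cons_union {A B : Set (List Bool)} (hA : A.Finite) (hB : B.Finite) :
    (List.cons false '' A ∪ List.cons true '' B).ncard = A.ncard + B.ncard := by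
  rw [Set.ncard_union_eq _ (hA.image _) (hB.image _),
    Set.ncard_image_of_injective _ List.cons_injective,
    Set.ncard_image_of_injective _ List.cons_injective]
  rw [Set.disjoint_left]
  rintro _ ⟨w, -, rfl⟩ ⟨w', -, h⟩
  simp at h

/-- Since all leaves are halted, the tree is complete. At a branching node the paths of the two
subtrees receive different first bits, so the counts add; a leaf contributes the empty path iff its
internal state accepts. -/
theorem Unfolds.acceptingFrom {t : ℕ} {O : Multiset (Cfg Γ Λ σ)} (h : Unfolds code c t O)
    (hO : ∀ d ∈ O, d.l = none) :
    (acceptingFrom code accept c).Finite ∧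
      (acceptingFrom code accept c).ncard = (O.filter fun d => accept d.var = true).card ∧
      ∀ w, (chooseRun code c w).isSome = true → w.length ≤ t := by
  induction h with
  | leaf c t =>
    have hc := hO c (by simp)
    rw [acceptingFrom_halted hc, Multiset.filter_singleton]
    refine ⟨by split_ifs <;> simp, by split_ifs <;> simp, fun w hw => ?_⟩
    cases w with
    | nil => simp
    | cons b w => simp [chooseRun, chooseStep, hc] at hw
  | @single l v S t O h₁ _ ih =>
    obtain ⟨ih₁, ih₂, ih₃⟩ := ih hO
    have e : chooseStep code true ⟨some l, v, S⟩ = none := by simp [chooseStep, h₁]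
    rw [acceptingFrom_single (by simp) rfl e]
    refine ⟨ih₁.image _, ?_, fun w hw => ?_⟩
    · rw [Set.ncard_image_of_injective _ List.cons_injective]
      exact ih₂
    · rcases w with _ | ⟨_ | _, w⟩
      · simp
      · exact Nat.succ_le_succ (ih₃ w hw)
      · simp [chooseRun, e] at hw
  | @double l v S t O O' s h₁ _ _ ih ih' =>
    obtain ⟨ih₁, ih₂, ih₃⟩ := ih fun d hd => hO d (by simp [hd])
    obtain ⟨ih₁', ih₂', ih₃'⟩ := ih' fun d hd => hO d (by simp [hd])
    have e : chooseStep code true ⟨some l, v, S⟩ = some (stepAux s v S) := by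
      simp [chooseStep, h₁]
    rw [acceptingFrom_double (by simp) rfl e]
    refine ⟨(ih₁.image _).union (ih₁'.image _), ?_, fun w hw => ?_⟩
    · rw [ncard_cons_union ih₁ ih₁', Multiset.filter_add, Multiset.card_add, ← ih₂', ← ih₂]
    · rcases w with _ | ⟨_ | _, w⟩
      · simp
      · exact Nat.succ_le_succ (ih₃ w hw)
      · simp only [chooseRun, e, Option.bind_some] at hw
        exact Nat.succ_le_succ (ih₃' w hw)

end Accepting

/-- The stacks that are all empty but for the stack `k`. -/
def stacksAt (k : K) (a : List (Γ k)) : ∀ j, List (Γ j) :=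
  Function.update (fun _ => []) k a

/-- The left side is the form to which the stacks of `initList` and `haltList` unfold. -/
theorem dite_eq_stacksAt (k : K) (a : List (Γ k)) :
    (fun j => @dite (List (Γ j)) (j = k) (inferInstance) (fun h => by rw [h]; exact a) fun _ => [])
      = stacksAt k a := by
  funext j
  by_cases h : j = k
  · subst h; simp [stacksAt]
  · simp [stacksAt, h]

end Programs

/-! ### From programs to deterministic and nondeterministic machines -/

section Machines

theorem initList_eq (tm : FinTM2) (a : List (tm.Γ tm.k₀)) :
    initList tm a = ⟨some tm.main, tm.initialState, stacksAt tm.k₀ a⟩ := by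
  rw [← dite_eq_stacksAt]
  rfl

theorem haltList_eq (tm : FinTM2) (a : List (tm.Γ tm.k₁)) :
    haltList tm a = ⟨none, tm.initialState, stacksAt tm.k₁ a⟩ := by
  rw [← dite_eq_stacksAt]
  rfl

/-- The first and the alternative statement at each label of a nondeterministic machine. -/
def NTM.code (M : NTM) (l : M.Λ) : Stmt M.Γ M.Λ M.σ × Option (Stmt M.Γ M.Λ M.σ) :=
  (M.m l, M.alt l)

theorem NTM.run_eq (M : NTM) (c : M.toFinTM2.Cfg) (w : List Bool) :
    M.run c w = chooseRun M.code c w := by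
  induction w generalizing c with
  | nil => rfl
  | cons b w ih =>
    have : M.step b c = chooseStep M.code b c := by
      rcases c with ⟨_ | l, v, S⟩ <;> cases b <;> rfl
    rw [run, this]
    exact congrArg _ (funext ih)

theorem NTM.acceptingPaths_eq (M : NTM) (x : List Bool) :
    M.acceptingPaths x = acceptingFrom M.code M.accept (M.init x) := by
  simp only [acceptingPaths, acceptingFrom, run_eq]
  rfl

variable {K : Type} {Γ : K → Type} {σ : Type} [DecidableEq K]
variable [Fintype K] [Fintype σ]

/-- The machine that runs a program. -/
def Prog.machine (P : Prog Γ σ) (k₀ k₁ : K) [Fintype (Γ k₀)] (v₀ : σ) : FinTM2 where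
  K := K
  k₀ := k₀
  k₁ := k₁
  Γ := Γ
  Λ := P.Lab
  main := P.entry
  σ := σ
  initialState := v₀
  m l := (P.code id none l).1

/-- The nondeterministic machine that runs a program. -/
def Prog.ntm (P : Prog Γ σ) (k₀ : K) (v₀ : σ) (ι : Γ k₀ ≃ Bool) (accept : σ → Bool) : NTM :=
  letI : Fintype (Γ k₀) := Fintype.ofEquiv Bool ι.symm
  { P.machine k₀ k₀ v₀ with
    inputAlphabet := ι
    alt := fun l => (P.code id none l).2
    accept := accept }

theorem Sem.outputs {X : Type} {enc : X → σ × ∀ k, List (Γ k)} {P : Prog Γ σ} {x y : X} {t : ℕ}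
    (h : Sem enc P x t {y}) (k₀ k₁ : K) [Fintype (Γ k₀)] (v₀ : σ) {a : List (Γ k₀)}
    {b : List (Γ k₁)} (hx : enc x = (v₀, stacksAt k₀ a)) (hy : enc y = (v₀, stacksAt k₁ b)) :
    Nonempty (TM2OutputsInTime (P.machine k₀ k₁ v₀) a (some b) t) := by
  have h₁ := h.unfolds
  rw [Multiset.map_singleton, hx, hy] at h₁
  obtain ⟨n, hn, h₂⟩ := h₁.evalsTo
  refine ⟨⟨⟨n, ?_⟩, hn⟩⟩
  have e₀ := initList_eq (P.machine k₀ k₁ v₀) a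
  have e₁ := haltList_eq (P.machine k₀ k₁ v₀) b
  exact (congrArg _ (congrArg some e₀)).trans (h₂.trans (congrArg some e₁.symm))

/-- The bridge from programs to `acc`: the final states in `O`, counted with multiplicity,
correspond to the computation paths, and the time bound limits the length of every partial path. -/
theorem Sem.acc_eq {X : Type} {enc : X → σ × ∀ k, List (Γ k)} {P : Prog Γ σ} {x : X} {t : ℕ}
    {O : Multiset X} (h : Sem enc P x t O) (k₀ : K) (v₀ : σ) (ι : Γ k₀ ≃ Bool)
    (accept : σ → Bool) {a : List Bool} (hx : enc x = (v₀, stacksAt k₀ (a.map ι.symm))) :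
    (P.ntm k₀ v₀ ι accept).acc a = (O.filter fun y => accept (enc y).1 = true).card ∧
      ∀ w, ((P.ntm k₀ v₀ ι accept).run ((P.ntm k₀ v₀ ι accept).init a) w).isSome = true →
        w.length ≤ t := by
  have h₁ := h.unfolds
  rw [hx] at h₁
  have e₀ : (P.ntm k₀ v₀ ι accept).init a = ⟨some P.entry, v₀, stacksAt k₀ (a.map ι.symm)⟩ :=
    initList_eq (P.ntm k₀ v₀ ι accept).toFinTM2 _
  have h₂ := h₁.acceptingFrom (accept := accept) (by simp)
  rw [Multiset.filter_map, Multiset.card_map] at h₂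
  refine ⟨?_, fun w hw => h₂.2.2 w ?_⟩
  · rw [NTM.acc, NTM.acceptingPaths_eq, e₀]
    exact h₂.2.1
  · rw [NTM.run_eq, e₀] at hw
    exact hw

end Machines
end ExactCounting

namespace ExactCounting

open Turing TM2

/-! ### Embedding a machine into a larger one -/

section Lift

variable {K K' : Type} [DecidableEq K] [DecidableEq K'] {Γ : K → Type} {σ Λ' σ' : Type}

/-- A statement of a machine whose stacks are among the stacks of a larger machine, as a statement
of the larger machine; the label to go to is recorded in the internal state. -/
def lift (ik : K' → K) (get : σ → σ') (set : σ' → σ → σ) (setLabel : Option Λ' → σ → σ) :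
    Stmt (fun k => Γ (ik k)) Λ' σ' → Stmt Γ Unit σ
  | .push k f q => .push (ik k) (fun v => f (get v)) (lift ik get set setLabel q)
  | .peek k f q => .peek (ik k) (fun v o => set (f (get v) o) v) (lift ik get set setLabel q)
  | .pop k f q => .pop (ik k) (fun v o => set (f (get v) o) v) (lift ik get set setLabel q)
  | .load f q => .load (fun v => set (f (get v)) v) (lift ik get set setLabel q)
  | .branch f q₁ q₂ => .branch (fun v => f (get v)) (lift ik get set setLabel q₁)
      (lift ik get set setLabel q₂)
  | .goto g => .load (fun v => setLabel (some (g (get v))) v) .halt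
  | .halt => .load (fun v => setLabel none v) .halt

/-- `mk` embeds small configurations into large states. The hypotheses say that reading and writing
the state, the label and the stacks commute with `mk`, so each instruction is simulated by its
lifted counterpart. -/
theorem exec_lift {ik : K' → K} {get : σ → σ'} {set : σ' → σ → σ} {setLabel : Option Λ' → σ → σ}
    (mk : Cfg (fun k => Γ (ik k)) Λ' σ' → σ × ∀ k, List (Γ k))
    (h_get : ∀ c, get (mk c).1 = c.var)
    (h_stk : ∀ c k, (mk c).2 (ik k) = c.stk k)
    (h_set : ∀ l v w S, (set w (mk ⟨l, v, S⟩).1, (mk ⟨l, v, S⟩).2) = mk ⟨l, w, S⟩)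
    (h_update : ∀ l v S k a, ((mk ⟨l, v, S⟩).1, Function.update (mk ⟨l, v, S⟩).2 (ik k) a) =
      mk ⟨l, v, Function.update S k a⟩)
    (h_label : ∀ l l' v S, (setLabel l' (mk ⟨l, v, S⟩).1, (mk ⟨l, v, S⟩).2) = mk ⟨l', v, S⟩)
    (s : Stmt (fun k => Γ (ik k)) Λ' σ') (l : Option Λ') (v : σ') (S : ∀ k, List (Γ (ik k))) :
    exec (lift ik get set setLabel s) (mk ⟨l, v, S⟩) = mk (stepAux s v S) := by
  induction s generalizing v S with
  | push k f q ih =>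
    have e : exec (lift ik get set setLabel (.push k f q)) (mk ⟨l, v, S⟩) =
      exec (lift ik get set setLabel q) ((mk ⟨l, v, S⟩).1, Function.update (mk ⟨l, v, S⟩).2 (ik k)
        (f (get (mk ⟨l, v, S⟩).1) :: (mk ⟨l, v, S⟩).2 (ik k))) := rfl
    rw [e, h_update, h_stk, h_get, ih]
    rfl
  | peek k f q ih =>
    have e : exec (lift ik get set setLabel (.peek k f q)) (mk ⟨l, v, S⟩) =
      exec (lift ik get set setLabel q) (set (f (get (mk ⟨l, v, S⟩).1)
        ((mk ⟨l, v, S⟩).2 (ik k)).head?) (mk ⟨l, v, S⟩).1, (mk ⟨l, v, S⟩).2) := rfl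
    rw [e, h_set, h_stk, h_get, ih]
    rfl
  | pop k f q ih =>
    have e : exec (lift ik get set setLabel (.pop k f q)) (mk ⟨l, v, S⟩) =
      exec (lift ik get set setLabel q) (set (f (get (mk ⟨l, v, S⟩).1)
        ((mk ⟨l, v, S⟩).2 (ik k)).head?) (mk ⟨l, v, S⟩).1,
        Function.update (mk ⟨l, v, S⟩).2 (ik k) ((mk ⟨l, v, S⟩).2 (ik k)).tail) := rfl
    have h := h_set l v (f v (S k).head?) S
    rw [Prod.ext_iff] at h
    rw [e, h_stk, h_get, show (mk ⟨l, v, S⟩).2 = (mk ⟨l, f v (S k).head?, S⟩).2 from h.2,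
      show set (f v (S k).head?) (mk ⟨l, v, S⟩).1 = (mk ⟨l, f v (S k).head?, S⟩).1 from h.1,
      h_update, ih]
    rfl
  | load f q ih =>
    have e : exec (lift ik get set setLabel (.load f q)) (mk ⟨l, v, S⟩) =
      exec (lift ik get set setLabel q) (set (f (get (mk ⟨l, v, S⟩).1)) (mk ⟨l, v, S⟩).1,
        (mk ⟨l, v, S⟩).2) := rfl
    rw [e, h_set, h_get, ih]
    rfl
  | branch f q₁ q₂ ih₁ ih₂ =>
    cases h : f v
    · simpa [exec, lift, h_get, h] using ih₂ v S
    · simpa [exec, lift, h_get, h] using ih₁ v S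
  | goto g => simp only [exec, lift, stepAux, h_get, h_label]
  | halt => simp only [exec, lift, stepAux, h_label]

/-- Branch according to a label recorded in the internal state. -/
noncomputable def select (f : σ → Option Λ') (s : Λ' → Stmt Γ Unit σ) (d : Stmt Γ Unit σ) :
    List Λ' → Stmt Γ Unit σ
  | [] => d
  | l :: ls =>
    open scoped Classical in .branch (fun v => decide (f v = some l)) (s l) (select f s d ls)

theorem exec_select {f : σ → Option Λ'} {s : Λ' → Stmt Γ Unit σ} {d : Stmt Γ Unit σ}
    {ls : List Λ'} (hls : ∀ l, l ∈ ls) (x : σ × ∀ k, List (Γ k)) :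
    exec (select f s d ls) x = exec ((f x.1).elim d s) x := by
  have h : ∀ ls : List Λ', (∀ l, f x.1 = some l → l ∈ ls) →
      exec (select f s d ls) x = exec ((f x.1).elim d s) x := by
    intro ls
    induction ls with
    | nil =>
      intro h
      cases e : f x.1 with
      | none => rfl
      | some l => exact absurd (h l e) (by simp)
    | cons l ls ih =>
      intro h
      by_cases e : f x.1 = some l
      · simp [exec, select, e]
      · refine Eq.trans ?_ (ih fun l' h' => ?_)
        · simp [exec, select, e]
        · have := h l' h'
          rcases List.mem_cons.1 this with rfl | h₂
          · exact absurd h' e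
          · exact h₂
  exact h ls fun l _ => hls l

/-- Pop all the listed stacks; set a flag if one of them was nonempty. -/
def popAll (set : σ → σ) : List K → Stmt Γ Unit σ
  | [] => .halt
  | k :: ks => .pop k (fun v o => if o.isSome then set v else v) (popAll set ks)

/-- Without repetitions each listed stack loses only its top symbol, and its emptiness test sees the
original content. Idempotence of `set` covers the case of several nonempty stacks. -/
theorem exec_popAll {set : σ → σ} (hset : ∀ v, set (set v) = set v) {ks : List K} (hks : ks.Nodup)
    (x : σ × ∀ k, List (Γ k)) :
    exec (popAll set ks) x = (open scoped Classical in if ∃ k ∈ ks, x.2 k ≠ [] then set x.1 else x.1,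
      fun k => if k ∈ ks then (x.2 k).tail else x.2 k) := by
  classical
  induction ks generalizing x with
  | nil => simp [exec, popAll]
  | cons k ks ih =>
    obtain ⟨hk, hks⟩ := List.nodup_cons.1 hks
    have e : exec (popAll set (k :: ks)) x = exec (popAll set ks)
      (if ((x.2 k).head?).isSome then set x.1 else x.1, Function.update x.2 k (x.2 k).tail) := rfl
    rw [e, ih hks]
    have h₁ : (∃ j ∈ ks, Function.update x.2 k (x.2 k).tail j ≠ []) ↔ ∃ j ∈ ks, x.2 j ≠ [] := by
      refine exists_congr fun j => and_congr_right fun hj => ?_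
      rw [Function.update_of_ne (by rintro rfl; exact hk hj)]
    refine Prod.ext ?_ ?_
    · simp only [h₁]
      by_cases h₂ : x.2 k = [] <;> by_cases h₃ : ∃ j ∈ ks, x.2 j ≠ [] <;>
        simp [h₂, h₃, hset]
    · funext j
      by_cases hj : j = k
      · subst hj; simp [hk]
      · simp [hj]

end Lift

/-! ### The combined store for both machines -/

/-- The names of the stacks of bits. -/
inductive Own
  | inp | inpTmp | clk | clkTmp | cnt | idx | idxTmp | val | valTmp
  deriving DecidableEq

instance : Fintype Own where
  elems := {.inp, .inpTmp, .clk, .clkTmp, .cnt, .idx, .idxTmp, .val, .valTmp}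
  complete k := by cases k <;> decide

variable (F : FinTM2) (N : NTM)

instance : Fintype F.K := F.kFin
instance : Fintype F.Λ := F.ΛFin
instance : Fintype F.σ := F.σFin

/-- The stacks: those of `F`, those of `N`, stacks of bits, and a stack for encoded pairs. -/
abbrev Stack : Type := F.K ⊕ N.K ⊕ Own ⊕ Unit

/-- The stack alphabets. -/
abbrev Alph : Stack F N → Type
  | .inl k => F.Γ k
  | .inr (.inl k) => N.Γ k
  | .inr (.inr (.inl _)) => Bool
  | .inr (.inr (.inr _)) => Bool ⊕ Bool

/-- The internal states: labels and internal states of `F` and `N`, and some registers. -/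
@[ext] structure Vars where
  fl : Option F.Λ
  fv : F.σ
  nl : Option N.Λ
  nv : N.σ
  buf : Option (Bool ⊕ Bool)
  sign : Bool
  flag : Bool
  neg : Bool

noncomputable instance : Fintype (Vars F N) :=
  Fintype.ofInjective (fun v => (v.fl, v.fv, v.nl, v.nv, v.buf, v.sign, v.flag, v.neg)) (by
    intro v w h
    simp only [Prod.mk.injEq] at h
    exact Vars.ext h.1 h.2.1 h.2.2.1 h.2.2.2.1 h.2.2.2.2.1 h.2.2.2.2.2.1 h.2.2.2.2.2.2.1
      h.2.2.2.2.2.2.2)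

/-- The states of a machine that can run `F` and `N`. -/
structure Store where
  f : Cfg F.Γ F.Λ F.σ
  n : Cfg N.Γ N.Λ N.σ
  p : List (Bool ⊕ Bool)
  o : Own → List Bool
  buf : Option (Bool ⊕ Bool)
  sign : Bool
  flag : Bool
  neg : Bool

variable {F N}

namespace Store

/-- The representation of a state by internal state and stacks. -/
def enc (s : Store F N) : Vars F N × ∀ k, List (Alph F N k) :=
  (⟨s.f.l, s.f.var, s.n.l, s.n.var, s.buf, s.sign, s.flag, s.neg⟩, fun
    | .inl k => s.f.stk k
    | .inr (.inl k) => s.n.stk k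
    | .inr (.inr (.inl k)) => s.o k
    | .inr (.inr (.inr _)) => s.p)

theorem update_enc_f (s : Store F N) (k : F.K) (a : List (F.Γ k)) :
    Function.update s.enc.2 (.inl k) a =
      (enc { s with f := { s.f with stk := Function.update s.f.stk k a } }).2 := by
  funext j
  rcases j with j | j | j | j
  · by_cases h : j = k
    · subst h; simp [enc]
    · simp [enc, h]
  all_goals simp [enc]

theorem update_enc_n (s : Store F N) (k : N.K) (a : List (N.Γ k)) :
    Function.update s.enc.2 (.inr (.inl k)) a =
      (enc { s with n := { s.n with stk := Function.update s.n.stk k a } }).2 := by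
  funext j
  rcases j with j | j | j | j
  · simp [enc]
  · by_cases h : j = k
    · subst h; simp [enc]
    · simp [enc, h]
  all_goals simp [enc]

theorem update_enc_o (s : Store F N) (k : Own) (a : List Bool) :
    Function.update s.enc.2 (.inr (.inr (.inl k))) a =
      (enc { s with o := Function.update s.o k a }).2 := by
  funext j
  rcases j with j | j | j | j
  · simp [enc]
  · simp [enc]
  · by_cases h : j = k
    · subst h; simp [enc]
    · simp [enc, h]
  · simp [enc]

theorem update_enc_p (s : Store F N) (a : List (Bool ⊕ Bool)) :
    Function.update s.enc.2 (.inr (.inr (.inr ()))) a = (enc { s with p := a }).2 := by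
  funext j
  rcases j with j | j | j | j <;> simp [enc]

end Store

/-- The statements of the machine. -/
abbrev Code (F : FinTM2) (N : NTM) := Stmt (Alph F N) Unit (Vars F N)

/-- The programs of the machine. -/
abbrev Program (F : FinTM2) (N : NTM) := Prog (Alph F N) (Vars F N)

/-- The bit in the buffer. -/
def bit : Option (Bool ⊕ Bool) → Bool
  | some (.inl b) => b
  | some (.inr b) => b
  | none => false

/-- Pop a bit into the buffer. -/
def popC (k : Own) : Code F N :=
  .pop (.inr (.inr (.inl k))) (fun v b => { v with buf := b.map Sum.inl }) .halt

/-- Push the bit that is in the buffer. -/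
def pushC (k : Own) : Code F N := .push (.inr (.inr (.inl k))) (fun v => bit v.buf) .halt

/-- Push a given bit. -/
def putC (k : Own) (b : Bool) : Code F N := .push (.inr (.inr (.inl k))) (fun _ => b) .halt

/-- Push the bit that is in the buffer to the input stack of `F`. -/
def pushF (g : Bool → F.Γ F.k₀) : Code F N := .push (.inl F.k₀) (fun v => g (bit v.buf)) .halt

/-- Push the bit that is in the buffer to the input stack of `N`. -/
def pushN (g : Bool → N.Γ N.k₀) : Code F N := .push (.inr (.inl N.k₀)) (fun v => g (bit v.buf)) .halt

/-- A statement of `F`. -/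
def liftF (s : Stmt F.Γ F.Λ F.σ) : Code F N :=
  lift (Γ := Alph F N) Sum.inl (fun v => v.fv) (fun w v => { v with fv := w })
    (fun l v => { v with fl := l }) s

/-- A statement of `N`. -/
def liftN (s : Stmt N.Γ N.Λ N.σ) : Code F N :=
  lift (Γ := Alph F N) (fun k => Sum.inr (Sum.inl k)) (fun v => v.nv) (fun w v => { v with nv := w })
    (fun l v => { v with nl := l }) s

namespace Store

/-- Replace the stacks of bits and the buffer. -/
def on (s : Store F N) (o : Own → List Bool) (c : Option (Bool ⊕ Bool)) : Store F N :=
  { s with o := o, buf := c }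

variable (s : Store F N) (o o' : Own → List Bool) (c c' : Option (Bool ⊕ Bool))

@[simp] theorem on_o : (s.on o c).o = o := rfl
@[simp] theorem on_sign : (s.on o c).sign = s.sign := rfl
@[simp] theorem on_on : (s.on o c).on o' c' = s.on o' c' := rfl

theorem exec_popC (k : Own) : exec (popC k) (s.on o c).enc =
    (s.on (Function.update o k (o k).tail) ((o k).head?.map Sum.inl)).enc :=
  Prod.ext rfl ((s.on o c).update_enc_o k _)

theorem exec_pushC (k : Own) : exec (pushC k) (s.on o c).enc =
    (s.on (Function.update o k (bit c :: o k)) c).enc :=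
  Prod.ext rfl ((s.on o c).update_enc_o k _)

theorem exec_putC (k : Own) (b : Bool) : exec (putC k b) (s.on o c).enc =
    (s.on (Function.update o k (b :: o k)) c).enc :=
  Prod.ext rfl ((s.on o c).update_enc_o k _)

/-- Replace the contents of the input stack of `F`. -/
def setInF (s : Store F N) (a : List (F.Γ F.k₀)) : Store F N :=
  { s with f := { s.f with stk := Function.update s.f.stk F.k₀ a } }

/-- Replace the contents of the input stack of `N`. -/
def setInN (s : Store F N) (a : List (N.Γ N.k₀)) : Store F N :=
  { s with n := { s.n with stk := Function.update s.n.stk N.k₀ a } }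

theorem exec_pushF (g : Bool → F.Γ F.k₀) (a : List (F.Γ F.k₀)) :
    exec (pushF g) ((s.setInF a).on o c).enc = ((s.setInF (g (bit c) :: a)).on o c).enc := by
  refine Prod.ext rfl ((((s.setInF a).on o c).update_enc_f F.k₀ _).trans ?_)
  simp [on, setInF, enc]

theorem exec_pushN (g : Bool → N.Γ N.k₀) (a : List (N.Γ N.k₀)) :
    exec (pushN g) ((s.setInN a).on o c).enc = ((s.setInN (g (bit c) :: a)).on o c).enc := by
  refine Prod.ext rfl ((((s.setInN a).on o c).update_enc_n N.k₀ _).trans ?_)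
  simp [on, setInN, enc]

theorem exec_liftF (q : Stmt F.Γ F.Λ F.σ) :
    exec (liftF q) s.enc = enc { s with f := stepAux q s.f.var s.f.stk } :=
  exec_lift (Γ := Alph F N) (ik := Sum.inl) (fun c => enc { s with f := c }) (fun _ => rfl) (fun _ _ => rfl)
    (fun _ _ _ _ => rfl)
    (fun l v S k a => Prod.ext rfl (update_enc_f { s with f := ⟨l, v, S⟩ } k a))
    (fun _ _ _ _ => rfl) q s.f.l s.f.var s.f.stk

theorem exec_liftN (q : Stmt N.Γ N.Λ N.σ) :
    exec (liftN q) s.enc = enc { s with n := stepAux q s.n.var s.n.stk } :=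
  exec_lift (Γ := Alph F N) (ik := fun k => Sum.inr (Sum.inl k)) (fun c => enc { s with n := c })
    (fun _ => rfl) (fun _ _ => rfl)
    (fun _ _ _ _ => rfl)
    (fun l v S k a => Prod.ext rfl (update_enc_n { s with n := ⟨l, v, S⟩ } k a))
    (fun _ _ _ _ => rfl) q s.n.l s.n.var s.n.stk

end Store

end ExactCounting

/-! ### Loops over stacks, copying, and unary and binary arithmetic -/

namespace ExactCounting

open Turing TM2

namespace Sem

variable {K : Type} {Γ : K → Type} {σ : Type} [DecidableEq K]
  {X α : Type} {enc : X → σ × ∀ k, List (Γ k)} {P Q : Prog Γ σ} {x : X} {t t' : ℕ}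

/-- The outcomes of the second part are given as a function of an abstract parameter `a`.
Injectivity of `g` allows this function to be transported to states, as the rule `Sem.seq` demands.
-/
theorem seq_map {g : α → X} (hg : Function.Injective g) {A : Multiset α} {O : α → Multiset X}
    (h : Sem enc P x t (A.map g)) (h' : ∀ a ∈ A, Sem enc Q (g a) t' (O a)) :
    Sem enc (.seq P Q) x (t + t') (A.bind O) := by
  have := h.seq (O' := Function.extend g O fun _ => 0) (t' := t') (Q := Q) fun y hy => by
    obtain ⟨a, ha, rfl⟩ := Multiset.mem_map.1 hy
    rw [hg.extend_apply]
    exact h' a ha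
  simpa [Multiset.bind_map, hg.extend_apply] using this

theorem again_map {b : σ → Bool} {g : α → X} (hg : Function.Injective g) {A : Multiset α}
    {O : α → Multiset X} (hb : b (enc x).1 = true) (h : Sem enc P x t (A.map g))
    (h' : ∀ a ∈ A, Sem enc (.loop b P) (g a) t' (O a)) :
    Sem enc (.loop b P) x (t + t' + 1) (A.bind O) := by
  have := h.again hb (O' := Function.extend g O fun _ => 0) (t' := t') fun y hy => by
    obtain ⟨a, ha, rfl⟩ := Multiset.mem_map.1 hy
    rw [hg.extend_apply]
    exact h' a ha
  simpa [Multiset.bind_map, hg.extend_apply] using this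

end Sem

variable {F : FinTM2} {N : NTM}

open Store (enc)

/-- Run `body` for each bit that is popped from a stack. -/
def drain (k : Own) (body : Program F N) : Program F N :=
  .seq (.basic (popC k)) (.loop (fun v => v.buf.isSome) (.seq body (.basic (popC k))))

/-- All results of going through a list of bits. -/
def outcomes {α : Type} (next : Bool → α → Multiset α) : List Bool → α → Multiset α
  | [], a => {a}
  | b :: l, a => (next b a).bind (outcomes next l)

theorem sem_pop (k : Own) (s : Store F N) (o c) : Sem enc (.basic (popC k)) (s.on o c) 1
    {s.on (Function.update o k (o k).tail) ((o k).head?.map Sum.inl)} :=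
  .basic (s.exec_popC o c k)

theorem sem_push (k : Own) (s : Store F N) (o c) : Sem enc (.basic (pushC k)) (s.on o c) 1
    {s.on (Function.update o k (bit c :: o k)) c} :=
  .basic (s.exec_pushC o c k)

theorem sem_put (k : Own) (b : Bool) (s : Store F N) (o c) : Sem enc (.basic (putC k b)) (s.on o c) 1
    {s.on (Function.update o k (b :: o k)) c} :=
  .basic (s.exec_putC o c k b)

theorem sem_congr {P : Program F N} {s s' : Store F N} {o o₁ o' o₁' : Own → List Bool} {c c'}
    {t t' : ℕ} (h : Sem enc P (s.on o c) t {s'.on o' c'}) (ho : o = o₁) (ho' : o' = o₁')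
    (ht : t ≤ t') : Sem enc P (s.on o₁ c) t' {s'.on o₁' c'} := by
  subst ho ho'
  exact h.mono ht

section Drain

variable {k : Own} {body : Program F N} {t : ℕ} {α : Type} {W : α → Store F N}
  {O : List Bool → α → Own → List Bool}

/-- Between iterations the state is described by the bits `l` still on `k` and a parameter `a`: `O l
a` gives the bit stacks, `W a` the rest. The body starts with the next bit already popped into the
buffer, and may leave any buffer content. Each bit costs `t` for the body, one pop and one loop
test. -/
theorem sem_drain {next : Bool → α → Multiset α} {Inv : List Bool → α → Prop}
    (hk : ∀ l a, O l a k = l)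
    (hW : ∀ l c, Function.Injective fun a => (W a).on (Function.update (O l a) k l.tail) c)
    (hbody : ∀ b l a, Inv (b :: l) a → ∃ c, Sem enc body
      ((W a).on (Function.update (O (b :: l) a) k l) (some (.inl b))) t
      ((next b a).map fun a' => (W a').on (O l a') c))
    (hInv : ∀ b l a, Inv (b :: l) a → ∀ a' ∈ next b a, Inv l a') {l : List Bool} {a : α}
    (ha : Inv l a) (c : Option (Bool ⊕ Bool)) :
    Sem enc (drain k body) ((W a).on (O l a) c) ((t + 2) * l.length + 2)
      ((outcomes next l a).map fun a' => (W a').on (O [] a') none) := by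
  refine ((sem_pop k _ _ _).seq_left (t' := (t + 2) * l.length + 1) ?_).mono (by omega)
  rw [hk]
  induction l generalizing a with
  | nil =>
    have e : Function.update (O [] a) k [] = O [] a := by
      rw [Function.update_eq_self_iff, hk]
    simp only [outcomes, Multiset.map_singleton, List.tail_nil, List.head?_nil, Option.map_none, e]
    exact (Sem.done rfl).mono (by simp)
  | cons b l ih =>
    obtain ⟨c', hb⟩ := hbody b l a ha
    have h₁ := hb.seq_right (Q := .basic (popC k)) (t' := 1)
      (g := fun s : Store F N => s.on (Function.update s.o k (s.o k).tail)
        ((s.o k).head?.map Sum.inl))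
      fun y _ => sem_pop k y y.o y.buf
    rw [Multiset.map_map] at h₁
    simp only [Function.comp_def, Store.on_o, Store.on_on, hk] at h₁
    rw [outcomes, Multiset.map_bind]
    refine (Sem.again_map (hW l _) rfl h₁ fun a' ha' => ih (hInv b l a ha a' ha')).mono ?_
    rw [List.length_cons]
    nlinarith

/-- The deterministic case. With a single outcome per iteration no injectivity is needed to keep
track of the parameter. -/
theorem sem_drain_single {next : Bool → α → α} (hk : ∀ l a, O l a k = l)
    (hbody : ∀ b l a, ∃ c, Sem enc body
      ((W a).on (Function.update (O (b :: l) a) k l) (some (.inl b))) t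
      {(W (next b a)).on (O l (next b a)) c})
    (l : List Bool) (a : α) (c : Option (Bool ⊕ Bool)) :
    Sem enc (drain k body) ((W a).on (O l a) c) ((t + 2) * l.length + 2)
      {(W (l.foldl (fun a b => next b a) a)).on (O [] (l.foldl (fun a b => next b a) a)) none} := by
  refine ((sem_pop k _ _ _).seq_left (t' := (t + 2) * l.length + 1) ?_).mono (by omega)
  rw [hk]
  induction l generalizing a with
  | nil =>
    have e : Function.update (O [] a) k [] = O [] a := by
      rw [Function.update_eq_self_iff, hk]
    simp only [List.foldl_nil, List.tail_nil, List.head?_nil, Option.map_none, e]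
    exact (Sem.done rfl).mono (by simp)
  | cons b l ih =>
    obtain ⟨c', hb⟩ := hbody b l a
    have h₁ := hb.seq_left (sem_pop k _ _ _)
    rw [hk] at h₁
    refine (Sem.again_left rfl h₁ (ih (next b a))).mono ?_
    rw [List.length_cons]
    nlinarith

end Drain

/-- Move a stack onto another one. -/
def moveP (k k' : Own) : Program F N := drain k (.basic (pushC k'))

theorem sem_moveP {k k' : Own} (hk : k ≠ k') (s : Store F N) (o c) :
    Sem enc (moveP k k') (s.on o c) (3 * (o k).length + 2)
      {s.on (Function.update (Function.update o k []) k' ((o k).reverse ++ o k')) none} := by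
  have h := sem_drain_single (F := F) (N := N) (k := k) (body := .basic (pushC k')) (t := 1)
    (W := fun _ => s) (O := fun l a => Function.update (Function.update o k l) k' a)
    (next := fun b a => b :: a) (fun l a => by simp [hk])
    (fun b l a => ⟨some (.inl b), by
      convert sem_push k' s _ _ using 3
      funext j
      by_cases h₁ : j = k'
      · subst h₁; simp [hk.symm, bit]
      · by_cases h₂ : j = k
        · subst h₂; simp [hk]
        · simp [h₁, h₂]⟩)
    (o k) (o k') c
  have e : ∀ l a : List Bool, l.foldl (fun a b => b :: a) a = l.reverse ++ a := by
    intro l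
    induction l with
    | nil => simp
    | cons b l ih => simp [ih]
  simp only [e, Function.update_eq_self] at h
  exact h

/-- Run `sink` for each bit of a stack, from the bottom to the top, and preserve the stack. -/
def copyP (k tmp : Own) (sink : Program F N) : Program F N :=
  .seq (moveP k tmp) (drain tmp (.seq (.basic (pushC k)) sink))

/-- Moving to `tmp` and back reverses twice, so `k` is restored. The sink meets the bottom bit
first, hence the right fold; a sink that pushes therefore reproduces the word in its original order.
-/
theorem sem_copyP {k tmp : Own} (hk : k ≠ tmp) {sink : Program F N} {α : Type} {W : α → Store F N}
    {e : Bool → α → α} {t : ℕ}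
    (hsink : ∀ b a o, Sem enc sink ((W a).on o (some (.inl b))) t {(W (e b a)).on o (some (.inl b))})
    (a : α) (o : Own → List Bool) (ho : o tmp = []) (c : Option (Bool ⊕ Bool)) :
    Sem enc (copyP k tmp sink) ((W a).on o c) ((t + 6) * (o k).length + 4)
      {(W ((o k).foldr e a)).on o none} := by
  have h₂ := sem_drain_single (F := F) (N := N) (k := tmp)
    (body := .seq (.basic (pushC k)) sink) (t := 1 + t) (W := fun a : List Bool × α => W a.2)
    (O := fun l a => Function.update (Function.update o k a.1) tmp l)
    (next := fun b a => (b :: a.1, e b a.2)) (fun l a => by simp)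
    (fun b l a => ⟨some (.inl b), by
      convert Sem.seq_left (sem_push k (W a.2) _ _) (hsink b a.2 _) using 3
      funext j
      by_cases h₁ : j = tmp
      · subst h₁; simp [hk.symm]
      · by_cases h₂ : j = k
        · subst h₂; simp [hk, bit]
        · simp [h₁, h₂]⟩)
    (o k).reverse ([], a) none
  have e₁ : ∀ l : List Bool, l.reverse.foldl (fun a b => (b :: a.1, e b a.2)) ([], a)
      = (l, l.foldr e a) := by
    intro l
    induction l with
    | nil => rfl
    | cons b l ih => simp [List.foldl_append, ih]
  have e₂ : Function.update o tmp [] = o := by rw [Function.update_eq_self_iff, ho]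
  rw [e₁] at h₂
  simp only [Function.update_eq_self, e₂] at h₂
  refine ((sem_moveP hk (W a) o c).seq_left (t' := (1 + t + 2) * (o k).reverse.length + 2) ?_).mono ?_
  · simpa [ho] using h₂
  · simp only [List.length_reverse]; nlinarith

/-- Add the length of the input to the unary number on `val`. -/
def addP : Program F N :=
  .seq (drain .inp (.seq (.basic (pushC .inpTmp)) (.basic (putC .val false)))) (moveP .inpTmp .inp)

theorem sem_addP (s : Store F N) {o} (h : o .inpTmp = []) (c) :
    Sem enc addP (s.on o c) (7 * (o .inp).length + 4)
      {s.on (Function.update o .val (List.replicate (o .inp).length false ++ o .val)) none} := by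
  have h₁ := sem_drain_single (F := F) (N := N) (k := .inp)
    (body := .seq (.basic (pushC .inpTmp)) (.basic (putC .val false))) (t := 2) (W := fun _ => s)
    (O := fun l (a : List Bool × List Bool) =>
      Function.update (Function.update (Function.update o .inp l) .inpTmp a.1) .val a.2)
    (next := fun b a => (b :: a.1, false :: a.2)) (fun l a => by simp)
    (fun b l a => ⟨some (.inl b), by
      convert Sem.seq_left (sem_push .inpTmp s _ _) (sem_put .val false s _ _) using 3
      funext j
      cases j <;> simp [bit]⟩)
    (o .inp) ([], o .val) c
  have e : ∀ l a a' : List Bool, l.foldl (fun a b => (b :: a.1, false :: a.2)) (a, a')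
        = (l.reverse ++ a, List.replicate l.length false ++ a') := by
    intro l
    induction l with
    | nil => simp
    | cons b l ih => simp [ih, List.replicate_succ']
  rw [e] at h₁
  have h₂ := h₁.seq_left (sem_moveP (F := F) (N := N) (k := .inpTmp) (k' := .inp) (by decide) s _ _)
  have e₁ : Function.update (Function.update (Function.update o .inp (o .inp)) .inpTmp []) .val
      (o .val) = o := by
    funext j
    cases j <;> simp [h]
  have e₂ : Function.update (Function.update (Function.update (Function.update (Function.update o
      .inp []) .inpTmp (o .inp).reverse) .val (List.replicate (o .inp).length false ++ o .val))
        .inpTmp []) .inp (o .inp) =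
      Function.update o .val (List.replicate (o .inp).length false ++ o .val) := by
    funext j
    cases j <;> simp [h]
  simp only [e₁, List.append_nil] at h₂
  simp only [ne_eq, reduceCtorEq, not_false_eq_true, Function.update_of_ne, Function.update_self,
    List.reverse_reverse, List.append_nil, e₂, List.length_reverse] at h₂
  exact h₂.mono (by omega)

/-- Multiply the unary number on `val` by the length of the input. -/
def mulP : Program F N := .seq (moveP .val .valTmp) (drain .valTmp addP)

theorem sem_mulP (s : Store F N) {o} (h : o .inpTmp = []) (h' : o .valTmp = []) {m : ℕ}
    (hm : o .val = List.replicate m false) (c) :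
    Sem enc mulP (s.on o c) ((7 * (o .inp).length + 9) * m + 4)
      {s.on (Function.update o .val (List.replicate (m * (o .inp).length) false)) none} := by
  have h₁ := sem_drain_single (F := F) (N := N) (k := .valTmp) (body := addP)
    (t := 7 * (o .inp).length + 4) (W := fun _ => s)
    (O := fun l (a : List Bool) => Function.update (Function.update o .valTmp l) .val a)
    (next := fun b a => List.replicate (o .inp).length false ++ a) (fun l a => by simp)
    (fun b l a => ⟨none, by
      refine sem_congr (sem_addP s (o := Function.update (Function.update o .valTmp l) .val a)
        (by simpa using h) (some (.inl b))) ?_ ?_ (by simp) <;>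
      · funext j
        cases j <;> simp⟩)
    (o .val).reverse [] none
  have e : ∀ (l : List Bool) (j : ℕ),
      l.foldl (fun a _ => List.replicate (o .inp).length false ++ a) (List.replicate j false)
        = List.replicate (j + l.length * (o .inp).length) false := by
    intro l
    induction l with
    | nil => simp
    | cons b l ih =>
      intro j
      rw [List.foldl_cons, List.replicate_append_replicate, ih, List.length_cons]
      congr 1
      ring
  have e := e (o .val).reverse 0
  rw [List.replicate_zero] at e
  rw [e] at h₁
  refine ((sem_moveP (by decide) s o c).seq_left
    (t' := (7 * (o .inp).length + 4 + 2) * (o .val).reverse.length + 2) ?_).mono ?_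
  · refine sem_congr h₁ ?_ ?_ le_rfl <;>
    · funext j
      cases j <;> simp [h', hm]
  · simp only [hm, List.length_reverse, List.length_replicate]
    nlinarith

/-- Horner's scheme on unary numbers: adding a constant is repeated pushing, and multiplying by the
variable is `mulP`, whose running time is polynomial because the intermediate value is. -/
theorem exists_polynomial_program (p : Polynomial ℕ) :
    ∃ (P : Program F N) (T : Polynomial ℕ), ∀ (s : Store F N) (o c), o .inpTmp = [] →
      o .val = [] → o .valTmp = [] → Sem enc P (s.on o c) (T.eval (o .inp).length)
        {s.on (Function.update o .val (List.replicate (p.eval (o .inp).length) false)) none} := by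
  induction p using Polynomial.recOnHorner with
  | M0 =>
    refine ⟨.basic (.load (fun v => { v with buf := none }) .halt), 1, fun s o c _ h₂ _ => ?_⟩
    have e : Function.update o .val [] = o := by rw [Function.update_eq_self_iff, h₂]
    simp only [Polynomial.eval_zero, List.replicate_zero, Polynomial.eval_one, e]
    exact .basic rfl
  | MC p a _ _ ih =>
    rename_i h₁ h₂
    -- Horner's recursion also supplies that `p` has zero constant coefficient and that `a` is
    -- nonzero; the latter would obstruct an induction on `a` that starts at zero.
    clear h₁ h₂
    induction a with
    | zero => simpa using ih
    | succ a iha =>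
      obtain ⟨P, T, h⟩ := iha
      refine ⟨.seq P (.basic (putC .val false)), T + 1, fun s o c h₁ h₂ h₃ => ?_⟩
      have := (h s o c h₁ h₂ h₃).seq_left (sem_put .val false s _ none)
      refine sem_congr this rfl ?_ (by simp)
      funext j
      cases j <;> simp [List.replicate_succ, ← add_assoc]
  | MX p _ ih =>
    obtain ⟨P, T, h⟩ := ih
    refine ⟨.seq P mulP, T + ((7 * Polynomial.X + 9) * p + 4), fun s o c h₁ h₂ h₃ => ?_⟩
    have := (h s o c h₁ h₂ h₃).seq_left (sem_mulP s (by simpa) (by simpa) (by simp; rfl) none)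
    simpa using this

/-- The successor of a binary number, least significant bit first. -/
def succBits : List Bool → List Bool
  | [] => [true]
  | false :: l => true :: l
  | true :: l => false :: succBits l

theorem succBits_encodePosNum (p : PosNum) :
    succBits (Computability.encodePosNum p) = Computability.encodePosNum p.succ := by
  induction p with
  | one => rfl
  | bit0 p ih => rfl
  | bit1 p ih => exact congrArg _ ih

theorem succBits_encodeNat (n : ℕ) :
    succBits (Computability.encodeNat n) = Computability.encodeNat (n + 1) := by
  unfold Computability.encodeNat
  rw [Nat.cast_succ, Num.add_one]
  cases (n : Num) with
  | zero => rfl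
  | pos p => exact succBits_encodePosNum p

/-- Increment the binary number on `idx`. -/
def incP : Program F N :=
  .seq (.basic (popC .idx)) (.seq (.loop (fun v => v.buf.isSome && bit v.buf)
    (.seq (.basic (putC .idxTmp false)) (.basic (popC .idx))))
    (.seq (.basic (putC .idx true)) (moveP .idxTmp .idx)))

/-- Carry propagation: ones at the low end are recorded as zeros on `idxTmp`. The loop stops after
popping a zero, or on finding the stack empty; in both cases the digit that is now missing is a one,
which is the `true` in the equation. -/
theorem sem_incP_loop (s : Store F N) (o : Own → List Bool) (l t : List Bool) :
    ∃ l' t' c, t'.reverse ++ true :: l' = t.reverse ++ succBits l ∧ t'.length ≤ t.length + l.length ∧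
      Sem enc (.loop (fun v => v.buf.isSome && bit v.buf)
        (.seq (.basic (putC .idxTmp false)) (.basic (popC .idx))))
        (s.on (Function.update (Function.update o .idx l.tail) .idxTmp t) (l.head?.map Sum.inl))
        (3 * l.length + 1)
        {s.on (Function.update (Function.update o .idx l') .idxTmp t') c} := by
  induction l generalizing t with
  | nil => exact ⟨[], t, _, by simp [succBits], by simp, (Sem.done rfl).mono (by simp)⟩
  | cons b l ih =>
    cases b with
    | false => exact ⟨l, t, _, by simp [succBits], by simp, (Sem.done rfl).mono (by simp)⟩
    | true =>
      obtain ⟨l', t', c, h₁, h₂, h₃⟩ := ih (false :: t)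
      refine ⟨l', t', c, by simp [h₁, succBits], by simp at h₂ ⊢; omega, ?_⟩
      have h₄ := (sem_put .idxTmp false s (Function.update (Function.update o .idx l) .idxTmp t)
        (some (.inl true))).seq_left (sem_pop .idx s _ _)
      refine (Sem.again_left rfl (t := 2) (sem_congr h₄ rfl (o₁' := Function.update (Function.update o
        .idx l.tail) .idxTmp (false :: t)) ?_ le_rfl) ?_).mono (t := 2 + (3 * l.length + 1) + 1)
        (by simp; omega)
      · funext j
        cases j <;> simp
      · simpa using h₃

theorem sem_incP (s : Store F N) {o} (h : o .idxTmp = []) (c) :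
    Sem enc incP (s.on o c) (6 * (o .idx).length + 5)
      {s.on (Function.update o .idx (succBits (o .idx))) none} := by
  obtain ⟨l', t', c', h₁, h₂, h₃⟩ := sem_incP_loop s o (o .idx) []
  have e : Function.update (Function.update o .idx (o .idx).tail) .idxTmp [] =
      Function.update o .idx (o .idx).tail := by
    funext j
    cases j <;> simp [h]
  rw [e] at h₃
  have h₄ := (sem_pop .idx s o c).seq_left (h₃.seq_left
    ((sem_put .idx true s _ _).seq_left (sem_moveP (k := .idxTmp) (k' := .idx) (by decide) s _ _)))
  refine sem_congr h₄ rfl ?_ ?_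
  · funext j
    cases j <;> simp [h, h₁]
  · simp at h₂ ⊢
    omega

end ExactCounting

namespace ExactCounting

open Turing TM2

/-! ### Bounds on stack heights -/

section Height

variable {K : Type} [DecidableEq K] {Γ : K → Type} {Λ σ : Type}

/-- A statement contains finitely many push instructions. The resulting bound on heights limits the
time needed to empty the stacks of a simulated machine, and the length of its output. -/
theorem exists_height_bound (s : Stmt Γ Λ σ) :
    ∃ B, ∀ v S k, ((stepAux s v S).stk k).length ≤ (S k).length + B := by
  induction s with
  | push k f q ih =>
    obtain ⟨B, hB⟩ := ih
    refine ⟨B + 1, fun v S j => (hB v _ j).trans ?_⟩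
    by_cases h : j = k
    · subst h; simp; omega
    · simp [h]
  | peek k f q ih =>
    obtain ⟨B, hB⟩ := ih
    exact ⟨B, fun v S j => hB _ _ j⟩
  | pop k f q ih =>
    obtain ⟨B, hB⟩ := ih
    refine ⟨B, fun v S j => (hB _ _ j).trans ?_⟩
    by_cases h : j = k
    · subst h; simp
    · simp [h]
  | load f q ih =>
    obtain ⟨B, hB⟩ := ih
    exact ⟨B, fun v S j => hB _ _ j⟩
  | branch f q₁ q₂ ih₁ ih₂ =>
    obtain ⟨B₁, h₁⟩ := ih₁
    obtain ⟨B₂, h₂⟩ := ih₂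
    refine ⟨B₁ + B₂, fun v S j => ?_⟩
    have h₁ := h₁ v S j
    have h₂ := h₂ v S j
    cases h : f v <;> simp only [stepAux, h, cond_true, cond_false] <;> omega
  | goto f => exact ⟨0, fun v S j => by simp⟩
  | halt => exact ⟨0, fun v S j => by simp⟩

theorem exists_uniform_height_bound {ι : Type} [Fintype ι] (m : ι → Stmt Γ Λ σ) :
    ∃ B, ∀ i v S k, ((stepAux (m i) v S).stk k).length ≤ (S k).length + B := by
  choose B hB using fun i => exists_height_bound (m i)
  refine ⟨∑ i, B i, fun i v S k => (hB i v S k).trans ?_⟩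
  have := Finset.single_le_sum (fun _ _ => Nat.zero_le _) (Finset.mem_univ i) (f := B)
  omega

theorem height_iterate {m : Λ → Stmt Γ Λ σ} {B : ℕ}
    (hB : ∀ l v S k, ((stepAux (m l) v S).stk k).length ≤ (S k).length + B) {n h : ℕ}
    {c d : Cfg Γ Λ σ} (hc : ∀ k, (c.stk k).length ≤ h)
    (hd : (flip bind (TM2.step m))^[n] (some c) = some d) (k : K) :
    (d.stk k).length ≤ h + n * B := by
  induction n generalizing c h with
  | zero =>
    obtain rfl : c = d := by simpa using hd
    simpa using hc k
  | succ n ih =>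
    rw [Function.iterate_succ_apply] at hd
    obtain ⟨_ | l, v, S⟩ := c
    · have e : ∀ n, (flip bind (TM2.step m))^[n] (none : Option (Cfg Γ Λ σ)) = none := by
        intro n
        induction n with
        | zero => rfl
        | succ n ih => rw [Function.iterate_succ_apply]; exact ih
      rw [show flip bind (TM2.step m) (some ⟨none, v, S⟩) = none from rfl, e] at hd
      simp at hd
    · refine (ih (h := h + B) (fun j => (hB l v S j).trans ?_) hd).trans (by rw [add_mul]; omega)
      exact Nat.add_le_add_right (hc j) _

end Height

variable {F : FinTM2} {N : NTM}

open Store (enc)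

namespace Store

/-- Replace the configuration of `F`. -/
def setF (s : Store F N) (c : Cfg F.Γ F.Λ F.σ) : Store F N := { s with f := c }

/-- Empty the stacks of `F` and `N`. -/
def clear (s : Store F N) : Store F N :=
  { s with f := { s.f with stk := fun _ => [] }, n := { s.n with stk := fun _ => [] }, flag := false }

/-- The state in which `F` and `N` are ready to start. -/
def base (F : FinTM2) (N : NTM) (sign : Bool) : Store F N where
  f := ⟨some F.main, F.initialState, fun _ => []⟩
  n := ⟨some N.main, N.initialState, fun _ => []⟩
  p := []
  o := fun _ => []
  buf := none
  sign := sign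
  flag := false
  neg := false

end Store

/-! ### Running `F` -/

/-- Run `F` until it halts. -/
noncomputable def runP : Program F N :=
  .loop (fun v => v.fl.isSome)
    (.basic (select (fun v => v.fl) (fun l => liftF (F.m l)) .halt Finset.univ.toList))

theorem sem_runP (s : Store F N) {n : ℕ} {c d : Cfg F.Γ F.Λ F.σ} (hd : d.l = none)
    (h : (flip bind (TM2.step F.m))^[n] (some c) = some d) :
    Sem enc runP (s.setF c) (2 * n + 1) {s.setF d} := by
  induction n generalizing c with
  | zero =>
    obtain rfl : c = d := by simpa using h
    exact Sem.done (by simp [enc, Store.setF, hd])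
  | succ n ih =>
    rw [Function.iterate_succ_apply] at h
    obtain ⟨_ | l, v, S⟩ := c
    · have e : ∀ n, (flip bind (TM2.step F.m))^[n] (none : Option (Cfg F.Γ F.Λ F.σ)) = none := by
        intro n
        induction n with
        | zero => rfl
        | succ n ih => rw [Function.iterate_succ_apply]; exact ih
      rw [show flip bind (TM2.step F.m) (some ⟨none, v, S⟩) = none from rfl, e] at h
      simp at h
    · refine (Sem.again_left (t := 1) rfl (.basic ?_) (ih h)).mono (by omega)
      rw [exec_select (by simp)]
      exact Store.exec_liftF _ _

/-! ### Clearing the stacks -/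

/-- The stacks of `F` and `N`. -/
noncomputable def machineStacks (F : FinTM2) (N : NTM) : List (Stack F N) :=
  (Finset.univ.toList (α := F.K)).map Sum.inl ++
    (Finset.univ.toList (α := N.K)).map fun k => Sum.inr (Sum.inl k)

theorem nodup_machineStacks : (machineStacks F N).Nodup := by
  refine List.Nodup.append ((Finset.nodup_toList _).map Sum.inl_injective)
    ((Finset.nodup_toList _).map (Sum.inr_injective.comp Sum.inl_injective)) ?_
  intro k h₁ h₂
  simp only [List.mem_map] at h₁ h₂
  obtain ⟨a, -, rfl⟩ := h₁
  obtain ⟨b, -, h⟩ := h₂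
  simp at h

/-- Empty the stacks of `F` and `N` and restart `F` and `N`. -/
noncomputable def resetP : Program F N :=
  .seq (.basic (.load (fun v => { v with flag := true }) .halt))
    (.seq (.loop (fun v => v.flag) (.seq (.basic (.load (fun v => { v with flag := false }) .halt))
      (.basic (popAll (fun v => { v with flag := true }) (machineStacks F N)))))
    (.basic (.load (fun v => { v with fl := some F.main, fv := F.initialState, nl := some N.main,
                                      nv := N.initialState, neg := false }) .halt)))

theorem exec_popAll_machineStacks (s : Store F N) :
    exec (popAll (fun v => { v with flag := true }) (machineStacks F N)) s.enc =
      enc { s with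
        f := { s.f with stk := fun k => (s.f.stk k).tail }
        n := { s.n with stk := fun k => (s.n.stk k).tail }
        flag := open scoped Classical in
          if (∃ k, s.f.stk k ≠ []) ∨ ∃ k, s.n.stk k ≠ [] then true else s.flag } := by
  classical
  rw [exec_popAll (set := fun v : Vars F N => { v with flag := true }) (fun _ => rfl) nodup_machineStacks]
  have e : (∃ k ∈ machineStacks F N, s.enc.2 k ≠ []) ↔
      (∃ k, s.f.stk k ≠ []) ∨ ∃ k, s.n.stk k ≠ [] := by
    constructor
    · rintro ⟨k, hk, h⟩
      rcases List.mem_append.1 hk with hk | hk <;> obtain ⟨j, -, rfl⟩ := List.mem_map.1 hk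
      · exact .inl ⟨j, h⟩
      · exact .inr ⟨j, h⟩
    · rintro (⟨k, h⟩ | ⟨k, h⟩)
      · exact ⟨.inl k, by simp [machineStacks], h⟩
      · exact ⟨.inr (.inl k), by simp [machineStacks], h⟩
  refine Prod.ext ?_ ?_
  · simp only [e]
    split_ifs <;> rfl
  · funext k
    rcases k with k | k | k | k <;> simp [machineStacks, enc]

/-- Each pass shortens every nonempty stack by one, and the flag is raised again only if some stack
was nonempty. So at most `h + 1` passes are made, each costing a test and two statements, followed
by one last test. -/
theorem sem_clear {s : Store F N} {h : ℕ} (hs : s.flag = true) (hf : ∀ k, (s.f.stk k).length ≤ h)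
    (hn : ∀ k, (s.n.stk k).length ≤ h) :
    Sem enc (.loop (fun v => v.flag) (.seq (.basic (.load (fun v => { v with flag := false }) .halt))
      (.basic (popAll (fun v => { v with flag := true }) (machineStacks F N)))))
      s (3 * h + 4) {s.clear} := by
  induction h generalizing s with
  | zero =>
    have hf' : s.f.stk = fun _ => [] := funext fun k => List.length_eq_zero_iff.1 (by simpa using hf k)
    have hn' : s.n.stk = fun _ => [] := funext fun k => List.length_eq_zero_iff.1 (by simpa using hn k)
    refine (Sem.again_left (t := 2) (t' := 1) (y := s.clear) hs
      (Sem.seq_left (y := { s with flag := false }) (.basic rfl) (.basic ?_)) (Sem.done rfl)).mono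
        (by omega)
    rw [exec_popAll_machineStacks]
    simp [Store.clear, hf', hn']
  | succ h ih =>
    by_cases hall : (∃ k, s.f.stk k ≠ []) ∨ ∃ k, s.n.stk k ≠ []
    · have := ih (s := { s with
          f := { s.f with stk := fun k => (s.f.stk k).tail }
          n := { s.n with stk := fun k => (s.n.stk k).tail }
          flag := true }) rfl (fun k => by have := hf k; simp; omega)
        (fun k => by have := hn k; simp; omega)
      refine (Sem.again_left (t := 2) hs
        (Sem.seq_left (y := { s with flag := false }) (.basic rfl) (.basic ?_)) this).mono (by omega)
      rw [exec_popAll_machineStacks]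
      simp only [if_pos hall]
    · have h' : (∀ k, s.f.stk k = []) ∧ ∀ k, s.n.stk k = [] := by push Not at hall; exact hall
      refine (Sem.again_left (t := 2) (t' := 1) (y := s.clear) hs
        (Sem.seq_left (y := { s with flag := false }) (.basic rfl) (.basic ?_)) (Sem.done rfl)).mono
          (by omega)
      rw [exec_popAll_machineStacks]
      rw [if_neg hall]
      simp only [Store.clear, h'.1, h'.2, List.tail_nil]

/-- Only the sign, the bit stacks and the buffer survive a reset. This makes the many paths of a
simulation end in the same state, up to the sign. -/
theorem sem_resetP {s : Store F N} {h : ℕ} (hp : s.p = []) (hf : ∀ k, (s.f.stk k).length ≤ h)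
    (hn : ∀ k, (s.n.stk k).length ≤ h) :
    Sem enc resetP s (3 * h + 6) {(Store.base F N s.sign).on s.o s.buf} := by
  have h₁ : Sem enc _ { s with flag := true } _ _ :=
    sem_clear (s := { s with flag := true }) (h := h) rfl hf hn
  refine (Sem.seq_left (y := { s with flag := true }) (.basic rfl) (h₁.seq_left
    (.basic (y := (Store.base F N s.sign).on s.o s.buf) ?_))).mono (t := 1 + (3 * h + 4 + 1))
      (by omega)
  rw [Store.on, Store.base, ← hp]
  rfl

/-! ### Nondeterministic loops controlled by the clock -/

/-- All results of `m` nondeterministic steps. -/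
def paths {α : Type} (adv : Bool → α → α) : ℕ → α → Multiset α
  | 0, a => {a}
  | m + 1, a => paths adv m (adv false a) + paths adv m (adv true a)

/-- For each tick of the clock, choose one of two statements. -/
def clockP (s : Bool → Code F N) : Program F N :=
  drain .clk (.seq (.basic (putC .clkTmp false)) (.flip (.basic (s false)) (.basic (s true))))

/-- The loop length is fixed by the clock and does not depend on the simulated computation, so every
path makes exactly `m` choices. Used ticks go to `clkTmp`, from which the clock can be restored for
the next round. -/
theorem sem_clockP {α : Type} {W : α → Store F N} {adv : Bool → α → α} {st : Bool → Code F N}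
    (hW : ∀ o c, Function.Injective fun a => (W a).on o c)
    (hst : ∀ b a o c, exec (st b) ((W a).on o c).enc = ((W (adv b a)).on o c).enc)
    {o : Own → List Bool} {m : ℕ} (h : o .clk = List.replicate m false) (h' : o .clkTmp = [])
    (a : α) (c) :
    Sem enc (clockP st) ((W a).on o c) (5 * m + 2) ((paths adv m a).map fun a' =>
      (W a').on (Function.update (Function.update o .clk []) .clkTmp (List.replicate m false))
        none) := by
  have h₁ := sem_drain (F := F) (N := N) (k := .clk)
    (body := .seq (.basic (putC .clkTmp false)) (.flip (.basic (st false)) (.basic (st true))))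
    (t := 3) (W := W)
    (O := fun l _ => Function.update (Function.update o .clk l) .clkTmp
      (List.replicate (m - l.length) false))
    (next := fun _ a => {adv false a} + {adv true a}) (Inv := fun l _ => l.length ≤ m)
    (fun l a => by simp) (fun l c => hW _ c)
    (fun b l a hl => ⟨some (.inl b), by
      have e : Function.update (Function.update (Function.update (Function.update o .clk (b :: l))
          .clkTmp (List.replicate (m - (b :: l).length) false)) .clk l) .clkTmp
          (false :: List.replicate (m - (b :: l).length) false) =
          Function.update (Function.update o .clk l) .clkTmp (List.replicate (m - l.length) false) := by
        funext j
        simp only [List.length_cons] at hl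
        cases j <;> simp [← List.replicate_succ, show m - (l.length + 1) + 1 = m - l.length by omega]
      have h₂ := sem_put .clkTmp false (W a) (Function.update (Function.update (Function.update o
        .clk (b :: l)) .clkTmp (List.replicate (m - (b :: l).length) false)) .clk l) (some (.inl b))
      refine (h₂.seq_left (t' := 2) (O := (({adv false a} + {adv true a} : Multiset α)).map _)
        ?_).mono le_rfl
      rw [Multiset.map_add, Multiset.map_singleton, Multiset.map_singleton]
      simp only [ne_eq, reduceCtorEq, not_false_eq_true, Function.update_of_ne,
        Function.update_self, e]
      exact .flip (.basic (hst false a _ _)) (.basic (hst true a _ _))⟩)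
    (fun b l a hl a' _ => by simp at hl; omega)
    (l := List.replicate m false) (a := a) (by simp) c
  have e₁ : ∀ (l : List Bool) (a : α),
      outcomes (fun _ a => {adv false a} + {adv true a}) l a = paths adv l.length a := by
    intro l
    induction l with
    | nil => intro a; rfl
    | cons b l ih => intro a; simp only [outcomes, paths, ih, Multiset.add_bind, Multiset.singleton_bind,
        List.length_cons]
  have e₂ : Function.update (Function.update o .clk (List.replicate m false)) .clkTmp [] = o := by
    funext j
    cases j <;> simp [h, h']
  rw [e₁] at h₁
  unfold clockP
  simpa [e₂] using h₁

end ExactCounting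

namespace ExactCounting

open Turing TM2

/-! ### Multisets of results of a fixed number of binary choices -/

section Paths

variable {α : Type} {adv : Bool → α → α}

theorem card_paths (m : ℕ) (a : α) : (paths adv m a).card = 2 ^ m := by
  induction m generalizing a with
  | zero => rfl
  | succ m ih => rw [paths, Multiset.card_add, ih, ih, pow_succ]; ring

/-- The predicate is indexed by the number of choices still to be made, so that it can express
bounds that grow along the path. -/
theorem mem_paths_of_forall {p : ℕ → α → Prop} (hp : ∀ m b a, p (m + 1) a → p m (adv b a)) {m : ℕ}
    {a a' : α} (ha : p m a) (h : a' ∈ paths adv m a) : p 0 a' := by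
  induction m generalizing a with
  | zero => rw [Multiset.mem_singleton.1 h]; exact ha
  | succ m ih =>
    rcases Multiset.mem_add.1 h with h | h
    · exact ih (hp m _ a ha) h
    · exact ih (hp m _ a ha) h

theorem card_filter_paths_le (p : α → Prop) [DecidablePred p] (m : ℕ) (a : α) :
    ((paths adv m a).filter p).card ≤ 2 ^ m :=
  (Multiset.card_le_card (Multiset.filter_le _ _)).trans (card_paths m a).le

theorem Multiset.map_ite_eq {β : Type} (A : Multiset α) (p : α → Bool) (u v : β) :
    A.map (fun a => if p a = true then u else v) =
      Multiset.replicate (A.filter fun a => p a = true).card u +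
        Multiset.replicate (A.card - (A.filter fun a => p a = true).card) v := by
  induction A using Multiset.induction_on with
  | empty => simp
  | cons a A ih =>
    have hle : (A.filter fun a => p a = true).card ≤ A.card :=
      Multiset.card_le_card (Multiset.filter_le _ _)
    cases h : p a
    · rw [Multiset.map_cons, ih, Multiset.filter_cons_of_neg _ (by simp [h])]
      simp only [h, Multiset.card_cons, Bool.false_eq_true, if_false]
      rw [Nat.succ_sub hle, Multiset.replicate_succ, Multiset.add_cons]
    · rw [Multiset.map_cons, ih, Multiset.filter_cons_of_pos (p := fun a => p a = true) _ h]
      simp only [h, Multiset.card_cons, if_true]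
      rw [Multiset.replicate_succ, Multiset.cons_add, Nat.add_sub_add_right]

end Paths

variable {F : FinTM2} {N : NTM}

open Store (enc)

/-! ### Trials: clocked nondeterministic computations that update the sign -/

/-- A clocked nondeterministic computation, an update of the sign, and a restart. -/
noncomputable def trialP (s : Bool → Code F N) (verdict : Code F N) : Program F N :=
  .seq (clockP s) (.seq (.basic verdict) (.seq resetP (moveP .clkTmp .clk)))

/-- After the reset the final state depends on the path only through `ok`, so the `2^m` results
collapse to two states with multiplicities. The time is `5m + 2` for the clocked loop, 1 for the
verdict, `3h + 6` for the reset and `3m + 2` for restoring the clock. -/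
theorem sem_trialP {α : Type} {W : α → Store F N} {adv : Bool → α → α} {st : Bool → Code F N}
    {verdict : Code F N} {ok : α → Bool} {sign : Bool}
    (hW : ∀ o c, Function.Injective fun a => (W a).on o c)
    (hst : ∀ b a o c, exec (st b) ((W a).on o c).enc = ((W (adv b a)).on o c).enc)
    (hverdict : ∀ a o c, exec verdict ((W a).on o c).enc =
      (Store.on { W a with sign := if ok a then sign else !sign } o c).enc)
    {o : Own → List Bool} {m h : ℕ} (ho : o .clk = List.replicate m false) (ho' : o .clkTmp = [])
    {a : α} (hp : ∀ a, (W a).p = [])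
    (hf : ∀ a' ∈ paths adv m a, ∀ k, ((W a').f.stk k).length ≤ h)
    (hn : ∀ a' ∈ paths adv m a, ∀ k, ((W a').n.stk k).length ≤ h) (c) :
    Sem enc (trialP st verdict) ((W a).on o c) (8 * m + 3 * h + 11)
      (Multiset.replicate ((paths adv m a).filter fun a => ok a = true).card
        ((Store.base F N sign).on o none) +
      Multiset.replicate (2 ^ m - ((paths adv m a).filter fun a => ok a = true).card)
        ((Store.base F N (!sign)).on o none)) := by
  have h₁ := sem_clockP hW hst ho ho' a c
  set o₂ := Function.update (Function.update o .clk []) .clkTmp (List.replicate m false) with ho₂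
  have h₂ := Sem.seq_map (Q := .seq (.basic verdict) (.seq resetP (moveP .clkTmp .clk)))
    (t' := 1 + (3 * h + 6 + (3 * m + 2))) (O := fun a => {if ok a = true then
      (Store.base F N sign).on o none else (Store.base F N (!sign)).on o none}) (hW o₂ none) h₁
    fun a' ha' => by
    have h₃ : Sem enc (.basic verdict) ((W a').on o₂ none) 1
      {Store.on { W a' with sign := if ok a' then sign else !sign } o₂ none} :=
        .basic (hverdict a' o₂ none)
    have h₄ := sem_resetP (s := Store.on { W a' with sign := if ok a' then sign else !sign } o₂ none)
      (h := h) (hp a') (hf a' ha') (hn a' ha')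
    have h₅ : Sem enc (moveP .clkTmp .clk)
        ((Store.base F N (if ok a' then sign else !sign)).on o₂ none) (3 * m + 2)
        {(Store.base F N (if ok a' then sign else !sign)).on o none} := by
      refine sem_congr (sem_moveP (by decide) _ o₂ none) rfl ?_ (by simp [ho₂])
      funext j
      cases j <;> simp [ho₂, ho, ho']
    have h₆ := h₃.seq_left (h₄.seq_left h₅)
    cases h : ok a' <;> simpa [h] using h₆
  rw [← card_paths (adv := adv) m a, ← Multiset.map_ite_eq, ← Multiset.bind_singleton]
  exact h₂.mono (by omega)

/-! ### The trial that runs `N` -/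

/-- One step of `N` under the choice `b`. The flag is set if this choice is not available, where a
machine that has halted may only choose `false`. -/
noncomputable def stepN (b : Bool) : Code F N :=
  .branch (fun v => v.flag) .halt (select (fun v => v.nl)
    (fun l => bif b then (N.alt l).elim (.load (fun v => { v with flag := true }) .halt) liftN
      else liftN (N.m l))
    (.load (fun v => { v with flag := b }) .halt) Finset.univ.toList)

/-- The effect of `stepN` on configuration and flag. -/
def advN (N : NTM) (b : Bool) (a : Cfg N.Γ N.Λ N.σ × Bool) : Cfg N.Γ N.Λ N.σ × Bool :=
  if a.2 then a else
    match chooseStep N.code b a.1 with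
    | some c => (c, false)
    | none => (a.1, a.1.l.isSome || b)

/-- Whether a configuration is accepting and the flag is not set. -/
def okN (N : NTM) (a : Cfg N.Γ N.Λ N.σ × Bool) : Bool :=
  !a.2 && a.1.l.isNone && N.accept a.1.var

/-- Change the sign unless `N` has accepted. -/
def verdictN : Code F N :=
  .load (fun v => { v with
    sign := if !v.flag && v.nl.isNone && N.accept v.nv then v.sign else !v.sign }) .halt

/-- Replace the configuration of `N` and the flag. -/
def Store.setN (s : Store F N) (a : Cfg N.Γ N.Λ N.σ × Bool) : Store F N :=
  { s with n := a.1, flag := a.2 }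

theorem exec_stepN (b : Bool) (s : Store F N) (a : Cfg N.Γ N.Λ N.σ × Bool) (o c) :
    exec (stepN b) ((s.setN a).on o c).enc = ((s.setN (advN N b a)).on o c).enc := by
  obtain ⟨⟨l, v, S⟩, d⟩ := a
  cases d with
  | true => rfl
  | false =>
    have e : exec (stepN b) ((s.setN (⟨l, v, S⟩, false)).on o c).enc = exec (select (fun v => v.nl)
        (fun l => bif b then (N.alt l).elim (.load (fun v => { v with flag := true }) .halt) liftN
          else liftN (N.m l))
        (.load (fun v => { v with flag := b }) .halt) Finset.univ.toList)
        ((s.setN (⟨l, v, S⟩, false)).on o c).enc := rfl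
    rw [e, exec_select (by simp)]
    cases l with
    | none => cases b <;> rfl
    | some l =>
      cases b with
      | false => exact Store.exec_liftN _ _
      | true =>
        cases h : N.alt l with
        | none =>
          have e : advN N true (⟨some l, v, S⟩, false) = (⟨some l, v, S⟩, true) := by
            simp [advN, chooseStep, NTM.code, h]
          rw [e]
          simp only [enc, Store.on, Store.setN, Option.elim_some, cond_true, h, Option.elim_none]
          rfl
        | some q =>
          have e : advN N true (⟨some l, v, S⟩, false) = (stepAux q v S, false) := by
            simp [advN, chooseStep, NTM.code, h]
          rw [e]
          have e' : (((s.setN (⟨some l, v, S⟩, false)).on o c).enc.1.nl).elim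
            (.load (fun v => { v with flag := true }) .halt)
            (fun l => bif true then (N.alt l).elim (.load (fun v => { v with flag := true }) .halt)
              liftN else liftN (N.m l)) = (liftN q : Code F N) := by
            simp [enc, Store.on, Store.setN, h]
          rw [e']
          exact Store.exec_liftN _ _

theorem exec_verdictN (sign : Bool) (a : Cfg N.Γ N.Λ N.σ × Bool) (o c) :
    exec verdictN (((Store.base F N sign).setN a).on o c).enc =
      (Store.on { (Store.base F N sign).setN a with sign := if okN N a then sign else !sign } o c).enc :=
  rfl

theorem setN_injective (s : Store F N) (o c) : Function.Injective fun a => (s.setN a).on o c := by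
  rintro ⟨a, b⟩ ⟨a', b'⟩ h
  simp only [Store.setN, Store.on, Store.mk.injEq] at h
  simp [h.2.1, h.2.2.2.2.2.2.1]

/-- Run `N` under the control of the clock. -/
noncomputable def branchN : Program F N :=
  .seq (copyP .inp .inpTmp (.basic (pushN N.inputAlphabet.symm))) (trialP stepN verdictN)

theorem setInN_base (sign : Bool) : (Store.base F N sign).setInN [] = Store.base F N sign := by
  simp [Store.base, Store.setInN]

theorem setInF_base (sign : Bool) : (Store.base F N sign).setInF [] = Store.base F N sign := by
  simp [Store.base, Store.setInF]

theorem foldr_cons_map {α β : Type} (g : α → β) (l : List α) (a : List β) :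
    l.foldr (fun b a => g b :: a) a = l.map g ++ a := by
  induction l with
  | nil => rfl
  | cons b l ih => simp [ih]

theorem height_advN {B₁ B₂ : ℕ}
    (h₁ : ∀ l v S k, ((stepAux (N.m l) v S).stk k).length ≤ (S k).length + B₁)
    (h₂ : ∀ l v S k, ((stepAux ((N.alt l).getD .halt) v S).stk k).length ≤ (S k).length + B₂)
    (b : Bool) (a : Cfg N.Γ N.Λ N.σ × Bool) (k : N.K) :
    ((advN N b a).1.stk k).length ≤ (a.1.stk k).length + (B₁ + B₂) := by
  obtain ⟨⟨l, v, S⟩, d⟩ := a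
  cases d with
  | true => simp [advN]
  | false =>
    cases l with
    | none => simp [advN, chooseStep]
    | some l =>
      cases b with
      | false => exact (h₁ l v S k).trans (by simp)
      | true =>
        have := h₂ l v S k
        cases h : N.alt l with
        | none => simp [advN, chooseStep, NTM.code, h]
        | some q =>
          simp only [h, Option.getD_some] at this
          simp only [advN, chooseStep, NTM.code, h, Option.map_some, Bool.false_eq_true, if_false]
          omega

theorem exists_sem_branchN (F : FinTM2) (N : NTM) : ∃ B, ∀ (sign : Bool) (o : Own → List Bool) (m c),
    o .clk = List.replicate m false → o .clkTmp = [] → o .inpTmp = [] →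
    Sem enc branchN ((Store.base F N sign).on o c)
      (8 * m + 3 * ((o .inp).length + m * B) + 11 + (7 * (o .inp).length + 4))
      (Multiset.replicate ((paths (advN N) m (N.init (o .inp), false)).filter
        fun a => okN N a = true).card ((Store.base F N sign).on o none) +
      Multiset.replicate (2 ^ m - ((paths (advN N) m (N.init (o .inp), false)).filter
        fun a => okN N a = true).card) ((Store.base F N (!sign)).on o none)) := by
  obtain ⟨B₁, h₁⟩ := exists_uniform_height_bound N.m
  -- A missing alternative is replaced by `.halt`, which changes no stack, so that one bound covers
  -- all labels.
  obtain ⟨B₂, h₂⟩ := exists_uniform_height_bound fun l => (N.alt l).getD .halt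
  refine ⟨B₁ + B₂, fun sign o m c hm hm' hi => ?_⟩
  have h₃ := sem_copyP (F := F) (N := N) (k := .inp) (tmp := .inpTmp) (by decide)
    (W := fun a => (Store.base F N sign).setInN a)
    (fun b a o => .basic (Store.exec_pushN _ o (some (.inl b)) N.inputAlphabet.symm a)) [] o hi c
  rw [setInN_base] at h₃
  have e : (N.init (o .inp) : Cfg N.Γ N.Λ N.σ) = ⟨some N.main, N.initialState,
    stacksAt N.k₀ ((o .inp).map N.inputAlphabet.symm)⟩ := initList_eq _ _
  have h₄ := sem_trialP (F := F) (N := N) (h := (o .inp).length + m * (B₁ + B₂))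
    (setN_injective (Store.base F N sign))
    (fun b a o c => exec_stepN b _ a o c) (exec_verdictN sign) hm hm'
    (a := (N.init (o .inp), false)) (fun _ => rfl) (fun _ _ k => by simp [Store.setN, Store.base])
    (fun a' ha' => by
      -- With `j` choices left, `m - j` steps have been made, each raising a stack by at most `B₁ +
      -- B₂` above the initial height.
      have := mem_paths_of_forall (p := fun j (a : Cfg N.Γ N.Λ N.σ × Bool) => j ≤ m ∧
        ∀ k, (a.1.stk k).length ≤ (o .inp).length + (m - j) * (B₁ + B₂)) ?_ ⟨le_rfl, ?_⟩ ha'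
      · have := this.2
        rw [Nat.sub_zero] at this
        exact this
      · rintro j b a ⟨hj, ha⟩
        refine ⟨by omega, fun k => ?_⟩
        have := height_advN (h₁ := h₁) (h₂ := h₂) b a k
        have := ha k
        have e : m - j = m - (j + 1) + 1 := by omega
        rw [e, add_mul]
        omega
      · intro k
        rw [e]
        by_cases hk : k = N.k₀
        · subst hk; simp [stacksAt]
        · simp [stacksAt, hk]) none
  refine (h₃.seq_left (Q := trialP stepN verdictN)
    (t' := 8 * m + 3 * ((o .inp).length + m * (B₁ + B₂)) + 11) ?_).mono (by omega)
  · rw [foldr_cons_map, List.append_nil]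
    have e' : (Store.base F N sign).setInN ((o .inp).map fun b =>
        N.inputAlphabet.symm (bit (some (.inl b)))) =
        (Store.base F N sign).setN (N.init (o .inp), false) := by
      rw [e]
      rfl
    rw [e']
    exact h₄

end ExactCounting

namespace ExactCounting

open Turing TM2

variable {F : FinTM2} {N : NTM}

open Store (enc)

/-! ### Counting the accepting paths of `N` -/

theorem card_paths_advN_true (m : ℕ) (c : Cfg N.Γ N.Λ N.σ) :
    ((paths (advN N) m (c, true)).filter fun a => okN N a = true).card = 0 := by
  induction m with
  | zero => simp [paths, okN, Multiset.filter_singleton]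
  | succ m ih =>
    have e : ∀ b, advN N b (c, true) = (c, true) := fun b => rfl
    rw [paths, e, e, Multiset.filter_add, Multiset.card_add, ih]

theorem advN_of_chooseStep {b : Bool} {c d : Cfg N.Γ N.Λ N.σ} (h : chooseStep N.code b c = some d) :
    advN N b (c, false) = (d, false) := by
  simp [advN, h]

/-- Each accepting path has exactly one accepted extension to `m` choices, namely by `false`
throughout: a halted machine that chooses `true`, like a running one that chooses a missing
alternative, raises the flag, and a raised flag is never lowered. -/
theorem ncard_acceptingFrom {m : ℕ} {c : Cfg N.Γ N.Λ N.σ}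
    (h : ∀ w, (chooseRun N.code c w).isSome = true → w.length ≤ m) :
    (acceptingFrom N.code N.accept c).Finite ∧ (acceptingFrom N.code N.accept c).ncard =
      ((paths (advN N) m (c, false)).filter fun a => okN N a = true).card := by
  induction m generalizing c with
  | zero =>
    have hc : c.l = none := by
      by_contra hc
      obtain ⟨l, hl⟩ := Option.ne_none_iff_exists'.1 hc
      have := h [false] (by simp [chooseRun, chooseStep, hl])
      simp at this
    rw [acceptingFrom_halted hc, paths, Multiset.filter_singleton]
    simp only [okN, hc]
    constructor <;> split_ifs <;> simp_all
  | succ m ih =>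
    rw [paths, Multiset.filter_add, Multiset.card_add]
    by_cases hc : c.l = none
    · have e₀ : advN N false (c, false) = (c, false) := by simp [advN, chooseStep, hc]
      have e₁ : advN N true (c, false) = (c, true) := by simp [advN, chooseStep, hc]
      rw [e₀, e₁, card_paths_advN_true]
      refine ih fun w hw => ?_
      cases w with
      | nil => simp
      | cons b w => simp [chooseRun, chooseStep, hc] at hw
    · obtain ⟨l, hl⟩ := Option.ne_none_iff_exists'.1 hc
      obtain ⟨d, hd⟩ : ∃ d, chooseStep N.code false c = some d := ⟨_, by simp only [chooseStep, hl]; rfl⟩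
      have hd' := ih (c := d) fun w hw => by
        simpa using h (false :: w) (by simpa [chooseRun, hd] using hw)
      rw [advN_of_chooseStep hd, ← hd'.2]
      cases he : chooseStep N.code true c with
      | none =>
        have e₁ : advN N true (c, false) = (c, true) := by simp [advN, he]
        rw [acceptingFrom_single hc hd he, e₁, card_paths_advN_true,
          Set.ncard_image_of_injective _ List.cons_injective]
        exact ⟨hd'.1.image _, rfl⟩
      | some e =>
        have he' := ih (c := e) fun w hw => by
          simpa using h (true :: w) (by simpa [chooseRun, he] using hw)
        rw [acceptingFrom_double hc hd he, advN_of_chooseStep he, ← he'.2,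
          ncard_cons_union hd'.1 he'.1]
        exact ⟨(hd'.1.image _).union (he'.1.image _), rfl⟩

/-- Always choosing `false` brings the machine to a halt with at least one tick to spare, and
choosing `true` at that tick is rejected. So not every sequence of choices is accepted. -/
theorem card_paths_advN_lt {m : ℕ} {c : Cfg N.Γ N.Λ N.σ}
    (h : ∀ w, (chooseRun N.code c w).isSome = true → w.length < m) :
    ((paths (advN N) m (c, false)).filter fun a => okN N a = true).card < 2 ^ m := by
  induction m generalizing c with
  | zero => simpa using h [] rfl
  | succ m ih =>
    rw [paths, Multiset.filter_add, Multiset.card_add, pow_succ]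
    by_cases hc : c.l = none
    · have e₁ : advN N true (c, false) = (c, true) := by simp [advN, chooseStep, hc]
      rw [e₁, card_paths_advN_true]
      have := card_filter_paths_le (adv := advN N) (fun a => okN N a = true) m
        (advN N false (c, false))
      have := Nat.two_pow_pos m
      omega
    · obtain ⟨l, hl⟩ := Option.ne_none_iff_exists'.1 hc
      obtain ⟨d, hd⟩ : ∃ d, chooseStep N.code false c = some d := ⟨_, by simp only [chooseStep, hl]; rfl⟩
      have hd' := ih (c := d) fun w hw => by
        simpa using h (false :: w) (by simpa [chooseRun, hd] using hw)
      rw [advN_of_chooseStep hd]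
      have := card_filter_paths_le (adv := advN N) (fun a => okN N a = true) m
        (advN N true (c, false))
      omega

theorem acc_eq_card_paths {m : ℕ} {x : List Bool}
    (h : ∀ w, (N.run (N.init x) w).isSome = true → w.length < m) :
    N.acc x = ((paths (advN N) m (N.init x, false)).filter fun a => okN N a = true).card ∧
      N.acc x < 2 ^ m := by
  have h' : ∀ w, (chooseRun N.code (N.init x) w).isSome = true → w.length < m := fun w hw =>
    h w (by rw [NTM.run_eq]; exact hw)
  have e : N.acc x = ((paths (advN N) m (N.init x, false)).filter fun a => okN N a = true).card := by
    rw [NTM.acc, NTM.acceptingPaths_eq]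
    exact (ncard_acceptingFrom fun w hw => (h' w hw).le).2
  exact ⟨e, e ▸ card_paths_advN_lt h'⟩

/-! ### The trial that compares a random number with the value of `F` -/

/-- Read the sign of the value of `F`. -/
def signF (out : F.Γ F.k₁ ≃ Bool) : Code F N :=
  .pop (.inl F.k₁) (fun v b => { v with neg := b.elim false out }) .halt

/-- Compare the next bit `y` with the next bit of the value of `F`. -/
def stepF (out : F.Γ F.k₁ ≃ Bool) (y : Bool) : Code F N :=
  .pop (.inl F.k₁) (fun v b => { v with
    flag := if y = b.elim false out then v.flag else b.elim false out }) .halt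

/-- Change the sign if the random number is smaller than the value of `F`, or if this value is
negative or has too many bits. -/
def verdictF : Code F N :=
  .peek (.inl F.k₁) (fun v b => { v with
    sign := if !v.flag && !v.neg && b.isNone then v.sign else !v.sign }) .halt

/-- The effect of `stepF` on the remaining bits and the flag. -/
def advF (y : Bool) (a : List Bool × Bool) : List Bool × Bool :=
  (a.1.tail, if y = a.1.headD false then a.2 else a.1.headD false)

/-- Whether no bit remains and the flag is not set. -/
def okF (neg : Bool) (a : List Bool × Bool) : Bool := !a.2 && !neg && a.1.isEmpty

/-- Replace the bits of the value of `F` and the flags. -/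
def Store.setOutF (s : Store F N) (out : F.Γ F.k₁ ≃ Bool) (neg : Bool) (a : List Bool × Bool) :
    Store F N :=
  { s with f := ⟨none, F.initialState, stacksAt F.k₁ (a.1.map out.symm)⟩, flag := a.2, neg := neg }

theorem update_setOutF (s : Store F N) (out : F.Γ F.k₁ ≃ Bool) (neg : Bool) (a : List Bool × Bool)
    (o c) (l : List Bool) :
    Function.update ((s.setOutF out neg a).on o c).enc.2 (.inl F.k₁) (l.map out.symm) =
      ((s.setOutF out neg (l, a.2)).on o c).enc.2 := by
  rw [Store.update_enc_f]
  simp [Store.setOutF, Store.on, stacksAt]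

theorem stk_setOutF (s : Store F N) (out : F.Γ F.k₁ ≃ Bool) (neg : Bool) (a : List Bool × Bool)
    (o c) : ((s.setOutF out neg a).on o c).enc.2 (.inl F.k₁) = a.1.map out.symm := by
  simp [Store.setOutF, Store.on, stacksAt, enc]

theorem exec_signF (s : Store F N) (out : F.Γ F.k₁ ≃ Bool) (b : Bool) (l : List Bool) (o c) :
    exec (signF out) ((s.setOutF out false (b :: l, false)).on o c).enc =
      ((s.setOutF out b (l, false)).on o c).enc := by
  simp only [exec, signF, stepAux, stk_setOutF]
  refine Prod.ext ?_ (update_setOutF s out false _ o c l)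
  simp [Store.setOutF, Store.on, enc]

theorem exec_stepF (out : F.Γ F.k₁ ≃ Bool) (neg y : Bool) (s : Store F N) (a : List Bool × Bool)
    (o c) : exec (stepF out y) ((s.setOutF out neg a).on o c).enc =
      ((s.setOutF out neg (advF y a)).on o c).enc := by
  obtain ⟨l, d⟩ := a
  simp only [exec, stepF, stepAux, stk_setOutF, ← List.map_tail]
  refine Prod.ext ?_ (update_setOutF s out neg _ o c l.tail)
  cases l <;> simp [Store.setOutF, Store.on, enc, advF]

theorem exec_verdictF (out : F.Γ F.k₁ ≃ Bool) (neg sign : Bool) (a : List Bool × Bool) (o c) :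
    exec verdictF (((Store.base F N sign).setOutF out neg a).on o c).enc =
      (Store.on { (Store.base F N sign).setOutF out neg a with
        sign := if okF neg a then sign else !sign } o c).enc := by
  obtain ⟨l, d⟩ := a
  simp only [exec, verdictF, stepAux, stk_setOutF]
  refine Prod.ext ?_ rfl
  cases l <;> simp [Store.setOutF, Store.on, Store.base, enc, okF]

theorem setOutF_injective (s : Store F N) (out : F.Γ F.k₁ ≃ Bool) (neg : Bool) (o c) :
    Function.Injective fun a => (s.setOutF out neg a).on o c := by
  rintro ⟨a, b⟩ ⟨a', b'⟩ h
  simp only [Store.setOutF, Store.on, Store.mk.injEq, Cfg.mk.injEq, true_and] at h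
  have h₁ := congrFun h.1 F.k₁
  simp only [stacksAt, Function.update_self] at h₁
  rw [List.map_injective_iff.2 out.symm.injective h₁, h.2.1]

/-- The number with the given bits, least significant bit first. -/
def bitsVal : List Bool → ℕ
  | [] => 0
  | b :: l => b.toNat + 2 * bitsVal l

theorem bitsVal_encodePosNum (p : PosNum) : bitsVal (Computability.encodePosNum p) = p ∧
    2 ^ (Computability.encodePosNum p).length ≤ 2 * (p : ℕ) := by
  induction p with
  | one => simp [Computability.encodePosNum, bitsVal]
  | bit0 p ih =>
    simp only [Computability.encodePosNum, bitsVal, ih.1, List.length_cons, pow_succ, PosNum.cast_bit0]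
    simp
    omega
  | bit1 p ih =>
    simp only [Computability.encodePosNum, bitsVal, ih.1, List.length_cons, pow_succ, PosNum.cast_bit1]
    simp
    omega

theorem bitsVal_encodeNat (n : ℕ) : bitsVal (Computability.encodeNat n) = n := by
  conv_rhs => rw [← Num.to_of_nat n]
  unfold Computability.encodeNat
  cases (n : Num) with
  | zero => rfl
  | pos p => exact (bitsVal_encodePosNum p).1

theorem two_pow_le_of_lt_length {n m : ℕ} (h : m < (Computability.encodeNat n).length) :
    2 ^ m ≤ n := by
  rw [← Num.to_of_nat n]
  unfold Computability.encodeNat at h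
  cases hn : (n : Num) with
  | zero => rw [hn] at h; simp [Computability.encodeNum] at h
  | pos p =>
    rw [hn] at h
    have h₁ := (bitsVal_encodePosNum p).2
    have h₂ : 2 ^ (m + 1) ≤ 2 ^ (Computability.encodePosNum p).length :=
      Nat.pow_le_pow_right (by omega) h
    rw [pow_succ] at h₂
    rw [Num.cast_pos]
    omega

/-- The bits are compared from the least significant one upwards, a later difference overriding
earlier ones, and bits missing from `l` count as zero. The flag acts as a borrow: the accepted
guesses are those of size at least `bitsVal l + d`, and there are `2^m` minus that many. -/
theorem card_paths_advF (m : ℕ) (l : List Bool) (d : Bool) (hl : l.length ≤ m) :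
    ((paths advF m (l, d)).filter fun a => okF false a = true).card + (bitsVal l + d.toNat) =
      2 ^ m := by
  induction m generalizing l d with
  | zero =>
    obtain rfl := List.length_eq_zero_iff.1 (Nat.le_zero.1 hl)
    cases d <;> simp [paths, okF, Multiset.filter_singleton, bitsVal]
  | succ m ih =>
    rw [paths, Multiset.filter_add, Multiset.card_add, pow_succ]
    have hl' : l.tail.length ≤ m := by simp; omega
    have h₀ := ih l.tail (if false = l.headD false then d else l.headD false) hl'
    have h₁ := ih l.tail (if true = l.headD false then d else l.headD false) hl'
    simp only [advF]
    rcases l with _ | ⟨_ | _, l⟩ <;> cases d <;> simp [bitsVal] at h₀ h₁ ⊢ <;> omega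

theorem card_paths_advF_neg (m : ℕ) (a : List Bool × Bool) :
    ((paths advF m a).filter fun a => okF true a = true).card = 0 := by
  simp [okF]

/-- Each choice consumes one bit, so some bit remains after `m` choices and the verdict rejects. -/
theorem card_paths_advF_long (m : ℕ) (l : List Bool) (d neg : Bool) (hl : m < l.length) :
    ((paths advF m (l, d)).filter fun a => okF neg a = true).card = 0 := by
  induction m generalizing l d with
  | zero =>
    have : l ≠ [] := List.ne_nil_of_length_pos hl
    simp [paths, okF, Multiset.filter_singleton, this]
  | succ m ih =>
    rw [paths, Multiset.filter_add, Multiset.card_add, advF, advF, ih _ _ (by simp; omega),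
      ih _ _ (by simp; omega)]

/-- The number of random numbers with `m` bits for which the sign is changed when the value of `F`
is `z`. -/
def threshold (m : ℕ) (z : ℤ) : ℕ :=
  if z < 0 ∨ m < (Computability.encodeNat z.natAbs).length then 2 ^ m else z.natAbs

theorem card_paths_threshold (m : ℕ) (z : ℤ) :
    ((paths advF m (Computability.encodeNat z.natAbs, false)).filter fun a =>
      okF (decide (z < 0)) a = true).card + threshold m z = 2 ^ m := by
  unfold threshold
  by_cases hz : z < 0
  · simp [hz, card_paths_advF_neg]
  · by_cases hl : m < (Computability.encodeNat z.natAbs).length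
    · simp [hl, card_paths_advF_long]
    · have := card_paths_advF m (Computability.encodeNat z.natAbs) false (by omega)
      rw [bitsVal_encodeNat] at this
      simpa [hz, hl] using this

/-- The substitute value `2^m` is out of reach for `a`. So is the integer it replaces: that one is
negative, or has more than `m` bits and is thus at least `2^m`. -/
theorem eq_threshold_iff {m a : ℕ} {z : ℤ} (ha : a < 2 ^ m) : a = threshold m z ↔ (a : ℤ) = z := by
  unfold threshold
  by_cases hz : z < 0
  · simp only [hz, true_or, if_true]
    omega
  · by_cases hl : m < (Computability.encodeNat z.natAbs).length
    · have := two_pow_le_of_lt_length hl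
      simp only [hl, or_true, if_true]
      omega
    · simp only [hz, hl, or_self, if_false]
      omega

end ExactCounting

/-! ### The trial for one value of `f` -/

namespace ExactCounting

open Turing TM2

variable {F : FinTM2} {N : NTM}

open Store (enc)

/-- Compute the value of `F` at the pair of the input and the index, and compare a random number
with it. -/
noncomputable def branchF (in₁ in₂ : Bool → F.Γ F.k₀) (out : F.Γ F.k₁ ≃ Bool) : Program F N :=
  .seq (copyP .idx .idxTmp (.basic (pushF in₂))) (.seq (copyP .inp .inpTmp (.basic (pushF in₁)))
    (.seq runP (.seq (.basic (signF out)) (trialP (stepF out) verdictF))))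

theorem length_le_of_mem_paths_advF {m : ℕ} {a a' : List Bool × Bool} (h : a' ∈ paths advF m a) :
    a'.1.length ≤ a.1.length :=
  mem_paths_of_forall (p := fun _ (b : List Bool × Bool) => b.1.length ≤ a.1.length)
    (fun _ _ b hb => by simp only [advF, List.length_tail]; omega) le_rfl h

theorem Polynomial.eval_nat_mono (p : Polynomial ℕ) {a b : ℕ} (h : a ≤ b) : p.eval a ≤ p.eval b := by
  rw [Polynomial.eval_eq_sum_range, Polynomial.eval_eq_sum_range]
  exact Finset.sum_le_sum fun i _ => by gcongr

theorem length_stacksAt_le {K : Type} [DecidableEq K] {Γ : K → Type} (k j : K) (a : List (Γ k)) :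
    (stacksAt k a j).length ≤ a.length := by
  by_cases h : j = k
  · subst h; simp [stacksAt]
  · simp [stacksAt, h]

theorem setF_base_input (sign : Bool) (a : List (F.Γ F.k₀)) :
    (Store.base F N sign).setInF a = (Store.base F N sign).setF (initList F a) := by
  rw [initList_eq]
  rfl

theorem sem_runP_of_outputs {a : List (F.Γ F.k₀)} {b : List (F.Γ F.k₁)} {t : ℕ}
    (h : TM2OutputsInTime F a (some b) t) (s : Store F N) :
    Sem enc runP (s.setF (initList F a)) (2 * t + 1) {s.setF (haltList F b)} :=
  (sem_runP s rfl h.evals_in_steps).mono (by have := h.steps_le_m; omega)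

theorem length_le_of_outputs {B : ℕ}
    (hB : ∀ l v S k, ((stepAux (F.m l) v S).stk k).length ≤ (S k).length + B)
    {a : List (F.Γ F.k₀)} {b : List (F.Γ F.k₁)} {t : ℕ} (h : TM2OutputsInTime F a (some b) t) :
    b.length ≤ a.length + t * B := by
  have h₁ := height_iterate (h := a.length) hB
    (fun k => by rw [initList_eq]; exact length_stacksAt_le _ _ _) h.evals_in_steps F.k₁
  rw [haltList_eq] at h₁
  simp only [stacksAt, Function.update_self] at h₁
  exact h₁.trans (by gcongr; exact h.steps_le_m)

theorem encode_pair (x : List Bool) (i : ℕ) : encodingPair.encode (x, i) =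
    x.map Sum.inl ++ (Computability.encodeNat i).map Sum.inr := rfl

theorem encode_int (z : ℤ) :
    encodingInt.encode z = decide (z < 0) :: Computability.encodeNat z.natAbs := rfl

theorem exists_sem_branchF (N : NTM) {f : List Bool × ℕ → ℤ}
    (h : TM2ComputableInPolyTime encodingPair.encode encodingInt.encode f) :
    ∃ (P : Program h.tm N) (B : ℕ), ∀ (sign : Bool) (o : Own → List Bool) (m i c),
      o .clk = List.replicate m false → o .clkTmp = [] → o .inpTmp = [] → o .idxTmp = [] →
      o .idx = Computability.encodeNat i → ∀ L, (o .inp).length + (o .idx).length ≤ L →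
      Sem enc P ((Store.base h.tm N sign).on o c) (8 * m + 10 * L +
        3 * (h.time.eval L * B) + 2 * h.time.eval L + 21)
        (Multiset.replicate (2 ^ m - threshold m (f (o .inp, i))) ((Store.base h.tm N sign).on o none) +
         Multiset.replicate (threshold m (f (o .inp, i))) ((Store.base h.tm N (!sign)).on o none)) := by
  obtain ⟨B, hB⟩ := exists_uniform_height_bound h.tm.m
  refine ⟨branchF (fun b => h.inputAlphabet.symm (.inl b)) (fun b => h.inputAlphabet.symm (.inr b))
    h.outputAlphabet, B, fun sign o m i c h₁ h₂ h₃ h₄ h₅ L hL => ?_⟩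
  -- The index is pushed before the input word, since the first component of the encoded pair has to
  -- lie on top.
  have s₁ := sem_copyP (F := h.tm) (N := N) (k := .idx) (tmp := .idxTmp) (by decide)
    (W := fun a => (Store.base h.tm N sign).setInF a)
    (fun b a o => .basic (Store.exec_pushF _ o (some (.inl b)) (fun b => h.inputAlphabet.symm (.inr b)) a))
    [] o h₄ c
  have s₂ := sem_copyP (F := h.tm) (N := N) (k := .inp) (tmp := .inpTmp) (by decide)
    (W := fun a => (Store.base h.tm N sign).setInF a)
    (fun b a o => .basic (Store.exec_pushF _ o (some (.inl b)) (fun b => h.inputAlphabet.symm (.inl b)) a))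
    ((o .idx).map (fun b => h.inputAlphabet.symm (.inr b))) o h₃ none
  rw [setInF_base, foldr_cons_map, List.append_nil] at s₁
  rw [foldr_cons_map] at s₂
  have e₁ : (o .inp).map (fun b => h.inputAlphabet.symm (.inl b)) ++
      (o .idx).map (fun b => h.inputAlphabet.symm (.inr b)) =
      (encodingPair.encode (o .inp, i)).map h.inputAlphabet.symm := by
    rw [encode_pair, h₅]
    simp [Function.comp_def]
  have hout := h.outputsFun (o .inp, i)
  have e₂ : (encodingPair.encode (o .inp, i)).length = (o .inp).length + (o .idx).length := by
    rw [encode_pair, h₅]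
    simp
  have ht : h.time.eval (encodingPair.encode (o .inp, i)).length ≤ h.time.eval L := by
    rw [e₂]
    exact Polynomial.eval_nat_mono _ hL
  have hlen := length_le_of_outputs hB hout
  simp only [encode_int, List.length_map, List.length_cons, e₂] at hlen
  have hτ : h.time.eval (encodingPair.encode (o .inp, i)).length * B ≤ h.time.eval L * B :=
    Nat.mul_le_mul_right _ ht
  rw [e₂] at hτ ht
  have s₃ := sem_runP_of_outputs hout ((Store.base h.tm N sign).on o none)
  have e₃ : ((Store.base h.tm N sign).on o none).setF (haltList h.tm
      ((encodingInt.encode (f (o .inp, i))).map h.outputAlphabet.invFun)) =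
      ((Store.base h.tm N sign).setOutF h.outputAlphabet false
        (encodingInt.encode (f (o .inp, i)), false)).on o none := by
    rw [haltList_eq]
    rfl
  rw [e₃, encode_int] at s₃
  have s₄ : Sem enc (.basic (signF h.outputAlphabet)) _ 1 {_} :=
    .basic (exec_signF (Store.base h.tm N sign) h.outputAlphabet (decide (f (o .inp, i) < 0))
      (Computability.encodeNat (f (o .inp, i)).natAbs) o none)
  -- The height bound is the input length plus the running time times the growth per step; it bounds
  -- the length of the computed value, which is all that is left on the stacks of the machine for
  -- `f`.
  have s₅ := sem_trialP (F := h.tm) (N := N) (h := L + h.time.eval L * B) (o := o)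
    (st := stepF h.outputAlphabet)
    (setOutF_injective (Store.base h.tm N sign) h.outputAlphabet (decide (f (o .inp, i) < 0)))
    (fun b a o' c => exec_stepF h.outputAlphabet (decide (f (o .inp, i) < 0)) b
      (Store.base h.tm N sign) a o' c)
    (exec_verdictF h.outputAlphabet (decide (f (o .inp, i) < 0)) sign) h₁ h₂
    (a := (Computability.encodeNat (f (o .inp, i)).natAbs, false)) (fun _ => rfl)
    (fun a' ha' k => by
      have h₆ := length_le_of_mem_paths_advF ha'
      have h₇ := length_stacksAt_le h.tm.k₁ k (a'.1.map h.outputAlphabet.symm)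
      rw [List.length_map] at h₇
      have h₈ := h₇.trans h₆
      simp only at h₈
      refine h₈.trans ?_
      omega)
    (fun _ _ k => by simp [Store.setOutF, Store.base]) none
  have h₈ := card_paths_threshold m (f (o .inp, i))
  rw [show ((paths advF m (Computability.encodeNat (f (o .inp, i)).natAbs, false)).filter fun a =>
      okF (decide (f (o .inp, i) < 0)) a = true).card = 2 ^ m - threshold m (f (o .inp, i)) by omega,
    Nat.sub_sub_self (by omega)] at s₅
  refine (s₁.seq_left (s₂.seq_left (Sem.seq_left (t := 2 * h.time.eval L + 1) ?_
    (s₄.seq_left s₅)))).mono ?_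
  · have e₄ : (Store.base h.tm N sign).setInF
        ((o .inp).map (fun b => h.inputAlphabet.symm (.inl (bit (some (.inl b))))) ++
          (o .idx).map (fun b => h.inputAlphabet.symm (.inr b))) =
        (Store.base h.tm N sign).setF (initList h.tm
          ((encodingPair.encode (o .inp, i)).map h.inputAlphabet.invFun)) :=
      (congrArg _ e₁).trans (setF_base_input sign _)
    rw [e₄]
    exact s₃.mono (by rw [e₂]; omega)
  · omega

end ExactCounting

/-! ### Composing rounds into a product -/

namespace ExactCounting

open Turing TM2

variable {F : FinTM2} {N : NTM}

open Store (enc)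

/-- Compute the value of a polynomial at the length of the input, in unary, on a given stack. -/
theorem exists_unary_program (p : Polynomial ℕ) {k : Own} (hk : .val ≠ k) :
    ∃ (P : Program F N) (T : Polynomial ℕ), ∀ (s : Store F N) (o c), o .inpTmp = [] →
      o .val = [] → o .valTmp = [] → o k = [] → Sem enc P (s.on o c) (T.eval (o .inp).length)
        {s.on (Function.update o k (List.replicate (p.eval (o .inp).length) false)) none} := by
  obtain ⟨P, T, h⟩ := exists_polynomial_program (F := F) (N := N) p
  refine ⟨.seq P (moveP .val k), T + (3 * p + 2), fun s o c h₁ h₂ h₃ h₄ => ?_⟩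
  refine sem_congr ((h s o c h₁ h₂ h₃).seq_left (sem_moveP hk s _ none)) rfl ?_ (by simp)
  have e : Function.update (Function.update o .val (List.replicate (p.eval (o .inp).length) false))
      .val [] = o := by
    rw [Function.update_idem, Function.update_eq_self_iff, h₂]
  rw [e, Function.update_self, Function.update_of_ne hk.symm, h₄, List.reverse_replicate,
    List.append_nil]

theorem length_encodeNat_le (n : ℕ) : (Computability.encodeNat n).length ≤ n := by
  by_contra h
  have := two_pow_le_of_lt_length (not_le.1 h)
  exact absurd this (not_le.2 Nat.lt_two_pow_self)

/-! ### Random walks on signs -/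

/-- Increment a counter; keep the sign in `p i` ways and change it in `m i` ways. -/
def signStep (p m : ℕ → ℕ) (a : Bool × ℕ) : Multiset (Bool × ℕ) :=
  Multiset.replicate (p a.2) (a.1, a.2 + 1) + Multiset.replicate (m a.2) (!a.1, a.2 + 1)

theorem replicate_bind {α β : Type} (n : ℕ) (a : α) (f : α → Multiset β) :
    (Multiset.replicate n a).bind f = n • f a := by
  rw [Multiset.bind, Multiset.map_replicate, Multiset.join, Multiset.sum_replicate]

/-- Keeping and changing the sign act on the pair of multiplicities by a symmetric two-by-two
matrix, whose eigenvalues are the difference and the sum of its two entries. Both are multiplicative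
along the walk. -/
theorem outcomes_signStep (p m : ℕ → ℕ) (l : List Bool) (s : Bool) (i : ℕ) :
    ∃ p' m' : ℕ, outcomes (fun _ => signStep p m) l (s, i) =
      Multiset.replicate p' (s, i + l.length) + Multiset.replicate m' (!s, i + l.length) ∧
      (p' : ℤ) - m' = ∏ j ∈ Finset.range l.length, ((p (i + j) : ℤ) - m (i + j)) ∧
      (p' : ℤ) + m' = ∏ j ∈ Finset.range l.length, ((p (i + j) : ℤ) + m (i + j)) := by
  induction l generalizing s i with
  | nil => exact ⟨1, 0, by simp [outcomes], by simp, by simp⟩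
  | cons b l ih =>
    obtain ⟨p₁, m₁, h₁, h₂, h₃⟩ := ih s (i + 1)
    obtain ⟨p₂, m₂, h₄, h₅, h₆⟩ := ih (!s) (i + 1)
    -- The multiplicities do not depend on the initial sign, because they are determined by their
    -- sum and their difference.
    have hp : (p₁ : ℤ) = p₂ := by linarith
    have hm : (m₁ : ℤ) = m₂ := by linarith
    rw [Nat.cast_inj] at hp hm
    subst hp hm
    have e : ∀ j, i + 1 + j = i + (j + 1) := fun j => by omega
    simp only [e] at h₂ h₃
    refine ⟨p i * p₁ + m i * m₁, p i * m₁ + m i * p₁, ?_, ?_, ?_⟩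
    · rw [outcomes, signStep, Multiset.add_bind, replicate_bind, replicate_bind, h₁, h₄]
      simp only [smul_add, Multiset.nsmul_replicate, Bool.not_not, Multiset.replicate_add,
        List.length_cons, e]
      abel
    · simp only [List.length_cons, Finset.prod_range_succ', ← h₂, Nat.add_zero]
      push_cast
      ring
    · simp only [List.length_cons, Finset.prod_range_succ', ← h₃, Nat.add_zero]
      push_cast
      ring

/-! ### The machine -/

/-- The number of accepting sequences of `m` choices of `N`. -/
noncomputable def acceptCount (N : NTM) (m : ℕ) (x : List Bool) : ℕ :=
  ((paths (advN N) m (N.init x, false)).filter fun a => okN N a = true).card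

/-- The multiplicities of the two sides of the coin flip add up. Their signed counts `2 acc - 2^m`
and `2^m - 2 threshold` combine to twice the difference, while the total is `2^(m+1)`. The index is
incremented before use, so rounds counted from 0 use the values at 1, 2, and so on. -/
theorem exists_sem_round (N : NTM) {f : List Bool × ℕ → ℤ}
    (h : TM2ComputableInPolyTime encodingPair.encode encodingInt.encode f) :
    ∃ (P : Program h.tm N) (B₁ B₂ : ℕ), ∀ (sign : Bool) (o : Own → List Bool) (m i c),
      o .clk = List.replicate m false → o .clkTmp = [] → o .inpTmp = [] → o .idxTmp = [] →
      o .idx = Computability.encodeNat i → ∀ L, (o .inp).length + (i + 1) ≤ L →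
      Sem enc P ((Store.base h.tm N sign).on o c) (8 * m + 16 * L + 3 * m * B₁ +
        3 * (h.time.eval L * B₂) + 2 * h.time.eval L + 27)
        ((signStep (fun i => acceptCount N m (o .inp) + (2 ^ m - threshold m (f (o .inp, i + 1))))
          (fun i => 2 ^ m - acceptCount N m (o .inp) + threshold m (f (o .inp, i + 1)))
          (sign, i)).map fun a => (Store.base h.tm N a.1).on
            (Function.update o .idx (Computability.encodeNat a.2)) none) := by
  obtain ⟨B₁, h₁⟩ := exists_sem_branchN h.tm N
  obtain ⟨P, B₂, h₂⟩ := exists_sem_branchF N h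
  refine ⟨.seq incP (.flip branchN P), B₁, B₂, fun sign o m i c hm hm' hi hi' hi'' L hL => ?_⟩
  have s₁ := sem_incP (Store.base h.tm N sign) hi' c
  rw [hi'', succBits_encodeNat] at s₁
  set o₁ := Function.update o .idx (Computability.encodeNat (i + 1)) with ho₁
  have hinp : o₁ .inp = o .inp := by simp [ho₁]
  have s₂ := h₁ sign o₁ m none (by simpa [ho₁]) (by simpa [ho₁]) (by simpa [ho₁])
  have hlen : (o₁ .idx).length ≤ i + 1 := by
    rw [ho₁, Function.update_self]
    exact length_encodeNat_le _
  have hlen' := length_encodeNat_le i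
  have s₃ := h₂ sign o₁ m (i + 1) none (by simpa [ho₁]) (by simpa [ho₁]) (by simpa [ho₁])
    (by simpa [ho₁]) (by simp [ho₁]) L (by rw [hinp]; omega)
  rw [hinp] at s₂ s₃
  have e : 3 * ((o .inp).length + m * B₁) = 3 * (o .inp).length + 3 * m * B₁ := by ring
  rw [e] at s₂
  have s₄ := s₁.seq_left (Sem.flip
    (s₂.mono (t' := 8 * m + 10 * L + 3 * m * B₁ + 3 * (h.time.eval L * B₂) + 2 * h.time.eval L + 21)
      (by omega))
    (s₃.mono (t' := 8 * m + 10 * L + 3 * m * B₁ + 3 * (h.time.eval L * B₂) + 2 * h.time.eval L + 21)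
      (by omega)))
  convert s₄.mono _ using 1
  · rw [signStep, Multiset.map_add, Multiset.map_replicate, Multiset.map_replicate]
    simp only [Multiset.replicate_add, acceptCount]
    rw [← ho₁]
    abel
  · omega

/-- The number of accepting paths of the machine is determined by the product of the differences
between the number of accepting paths of `N` and the values of `f`. -/
theorem exists_sem_product (N : NTM) (q r : Polynomial ℕ) {f : List Bool × ℕ → ℤ}
    (h : TM2ComputableInPolyTime encodingPair.encode encodingInt.encode f) :
    ∃ (P : Program h.tm N) (T : Polynomial ℕ), ∀ x : List Bool, ∃ O,
      Sem enc P ((Store.base h.tm N true).on (Function.update (fun _ => []) .inp x) none)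
        (T.eval x.length) O ∧
      2 * ((O.filter fun y => y.sign = true).card : ℤ) =
        2 ^ ((q.eval x.length + 1) * r.eval x.length) + ∏ j ∈ Finset.range (r.eval x.length),
          (2 * ((acceptCount N (q.eval x.length) x : ℤ) -
            threshold (q.eval x.length) (f (x, j + 1)))) := by
  obtain ⟨P₁, T₁, h₁⟩ := exists_unary_program (F := h.tm) (N := N) r (k := .cnt) (by decide)
  obtain ⟨P₂, T₂, h₂⟩ := exists_unary_program (F := h.tm) (N := N) q (k := .clk) (by decide)
  obtain ⟨P₃, B₁, B₂, h₃⟩ := exists_sem_round N h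
  refine ⟨.seq P₁ (.seq P₂ (drain .cnt P₃)), T₁ + (T₂ + ((8 * q + 16 * (.X + r) +
    3 * q * .C B₁ + 3 * (h.time.comp (.X + r) * .C B₂) + 2 * h.time.comp (.X + r) + 27 + 2) * r + 2)),
    fun x => ?_⟩
  generalize hm : q.eval x.length = m
  generalize hR : r.eval x.length = R
  set o₀ : Own → List Bool := Function.update (fun _ => []) .inp x with ho₀
  set o : Own → List Bool := Function.update o₀ .clk (List.replicate m false) with ho
  have s₁ := h₁ (Store.base h.tm N true) o₀ none (by simp [ho₀]) (by simp [ho₀]) (by simp [ho₀])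
    (by simp [ho₀])
  have s₂ := h₂ (Store.base h.tm N true) (Function.update o₀ .cnt (List.replicate R false)) none
    (by simp [ho₀]) (by simp [ho₀]) (by simp [ho₀]) (by simp [ho₀])
  have hinp : o .inp = x := by simp [ho, ho₀]
  have s₃ := sem_drain (F := h.tm) (N := N) (k := .cnt) (body := P₃)
    (t := 8 * m + 16 * (x.length + R) + 3 * m * B₁ + 3 * (h.time.eval (x.length + R) * B₂) +
      2 * h.time.eval (x.length + R) + 27) (W := fun a : Bool × ℕ => Store.base h.tm N a.1)
    (O := fun l a => Function.update (Function.update o .cnt l) .idx (Computability.encodeNat a.2))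
    (next := fun _ => signStep (fun i => acceptCount N m x + (2 ^ m - threshold m (f (x, i + 1))))
          (fun i => 2 ^ m - acceptCount N m x + threshold m (f (x, i + 1))))
    -- The invariant keeps the index at most `R`, so that one time bound, with `L = |x| + R`, serves
    -- all rounds.
    (Inv := fun l a => a.2 + l.length ≤ R) (fun l a => by simp)
    (by
      rintro l c ⟨s, i⟩ ⟨s', i'⟩ e
      have e₁ := congrArg Store.sign e
      have e₂ := congrFun (congrArg Store.o e) .idx
      simp only [Store.on_o, ne_eq, reduceCtorEq, not_false_eq_true, Function.update_of_ne,
        Function.update_self] at e₂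
      have e₃ := congrArg Computability.decodeNat e₂
      rw [Computability.decode_encodeNat, Computability.decode_encodeNat] at e₃
      rw [e₃, show s = s' from e₁])
    (by
      rintro b l ⟨s, i⟩ hi
      simp only [List.length_cons] at hi
      have e : Function.update (Function.update (Function.update o .cnt (b :: l)) .idx
          (Computability.encodeNat i)) .cnt l =
          Function.update (Function.update o .cnt l) .idx (Computability.encodeNat i) := by
        funext j
        cases j <;> simp
      have := h₃ s (Function.update (Function.update o .cnt l) .idx (Computability.encodeNat i)) m i
        (some (.inl b)) (by simp [ho]) (by simp [ho, ho₀]) (by simp [ho, ho₀]) (by simp [ho, ho₀])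
        (by simp) (x.length + R) (by simp [hinp]; omega)
      refine ⟨none, ?_⟩
      rw [e]
      simpa [hinp] using this)
    (by
      rintro b l ⟨s, i⟩ hi a' ha'
      simp only [List.length_cons] at hi
      rcases Multiset.mem_add.1 ha' with ha' | ha' <;>
      · rw [Multiset.eq_of_mem_replicate ha']
        simp only
        omega)
    (l := List.replicate R false) (a := (true, 0)) (by simp) none
  -- The empty stack `idx` already represents the index 0.
  have e₁ : Function.update (Function.update o .cnt (List.replicate R false)) .idx
      (Computability.encodeNat 0) = Function.update (Function.update o₀ .cnt
        (List.replicate R false)) .clk (List.replicate m false) := by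
    funext j
    cases j <;> simp [ho, ho₀]
    rfl
  have e₂ : (o₀ .inp) = x := by simp [ho₀]
  have e₃ : Function.update o₀ .cnt (List.replicate R false) .inp = x := by simp [ho₀]
  rw [e₂, hR] at s₁
  rw [e₃, hm] at s₂
  rw [e₁] at s₃
  refine ⟨_, (s₁.seq_left (s₂.seq_left s₃)).mono ?_, ?_⟩
  · simp [Polynomial.eval_comp, hm, hR]
  · obtain ⟨p', m', h₄, h₅, h₆⟩ := outcomes_signStep
      (fun i => acceptCount N m x + (2 ^ m - threshold m (f (x, i + 1))))
      (fun i => 2 ^ m - acceptCount N m x + threshold m (f (x, i + 1)))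
      (List.replicate R false) true 0
    have hle : acceptCount N m x ≤ 2 ^ m := card_filter_paths_le _ _ _
    have hle' : ∀ z, threshold m z ≤ 2 ^ m := fun z => by
      have := card_paths_threshold m z
      omega
    have h₇ : ((((outcomes (fun _ => signStep
        (fun i => acceptCount N m x + (2 ^ m - threshold m (f (x, i + 1))))
        (fun i => 2 ^ m - acceptCount N m x + threshold m (f (x, i + 1))))
        (List.replicate R false) (true, 0)).map fun a' => (Store.base h.tm N a'.1).on
          (Function.update (Function.update o .cnt []) .idx (Computability.encodeNat a'.2)) none)).filter
            fun y => y.sign = true).card = p' := by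
      rw [h₄, Multiset.map_add, Multiset.filter_add, Multiset.map_replicate, Multiset.map_replicate,
        Multiset.filter_eq_self.2, Multiset.filter_eq_nil.2]
      · simp
      · intro a ha
        rw [Multiset.eq_of_mem_replicate ha]
        simp [Store.base]
      · intro a ha
        rw [Multiset.eq_of_mem_replicate ha]
        simp [Store.base]
    rw [h₇]
    have h₈ : ∀ j, (2 : ℤ) * ((acceptCount N m x : ℤ) - threshold m (f (x, j + 1))) =
        ((acceptCount N m x + (2 ^ m - threshold m (f (x, j + 1))) : ℕ) : ℤ) -
        ((2 ^ m - acceptCount N m x + threshold m (f (x, j + 1)) : ℕ) : ℤ) := fun j => by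
      have := hle' (f (x, j + 1))
      push_cast [hle, hle']
      ring
    have h₉ : ∀ j, ((acceptCount N m x + (2 ^ m - threshold m (f (x, j + 1))) : ℕ) : ℤ) +
        ((2 ^ m - acceptCount N m x + threshold m (f (x, j + 1)) : ℕ) : ℤ) = 2 ^ (m + 1) := fun j => by
      have := hle' (f (x, j + 1))
      push_cast [hle, hle']
      ring
    simp only [List.length_replicate, Nat.zero_add] at h₅ h₆
    -- Twice `p'` is the sum of `p' + m'`, a power of two by `h₉`, and `p' - m'`, the product of
    -- differences by `h₈`.
    rw [Finset.prod_congr rfl fun j _ => h₈ j, ← h₅, pow_mul]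
    rw [Finset.prod_congr rfl fun j _ => h₉ j, Finset.prod_const, Finset.card_range] at h₆
    linarith

end ExactCounting

/-! ### The target function and the two inclusions -/

namespace ExactCounting

open Turing TM2

theorem Sem.inFP {K : Type} {Γ : K → Type} {σ X α Γ' : Type} [DecidableEq K] [Fintype K] [Fintype σ]
    {enc : X → σ × ∀ k, List (Γ k)} {P : Prog Γ σ} (e : Computability.Encoding α Γ') {f : α → ℤ}
    (k₀ k₁ : K) [Fintype (Γ k₀)] (v₀ : σ) (ι₀ : Γ k₀ ≃ Γ') (ι₁ : Γ k₁ ≃ Bool) (T : Polynomial ℕ)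
    (h : ∀ a, ∃ x y, Sem enc P x (T.eval (e.encode a).length) {y} ∧
      enc x = (v₀, stacksAt k₀ ((e.encode a).map ι₀.symm)) ∧
      enc y = (v₀, stacksAt k₁ ((encodingInt.encode (f a)).map ι₁.symm))) : InFP e f := by
  choose x y h hx hy using h
  exact ⟨{ tm := P.machine k₀ k₁ v₀
           inputAlphabet := ι₀
           outputAlphabet := ι₁
           time := T
           outputsFun := fun a => ((h a).outputs k₀ k₁ v₀ (hx a) (hy a)).some }⟩

variable {F : FinTM2} {N : NTM}

open Store (enc)

theorem enc_base (sign : Bool) : (Store.base F N sign).enc.2 = fun _ => [] := by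
  funext j
  rcases j with j | j | j | j <;> rfl

theorem enc_base_on (sign : Bool) (k : Own) (a : List Bool) :
    ((Store.base F N sign).on (Function.update (fun _ => []) k a) none).enc =
      ((Store.base F N sign).enc.1, stacksAt (.inr (.inr (.inl k))) a) :=
  Prod.ext rfl (((Store.base F N sign).update_enc_o k a).symm.trans (by rw [enc_base, stacksAt]))

theorem encodeNat_two_pow (k : ℕ) :
    Computability.encodeNat (2 ^ k) = List.replicate k false ++ [true] := by
  have h : ∀ k, ∃ p : PosNum, ((2 ^ k : ℕ) : Num) = Num.pos p ∧
      Computability.encodePosNum p = List.replicate k false ++ [true] := by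
    intro k
    induction k with
    | zero => exact ⟨1, rfl, rfl⟩
    | succ k ih =>
      obtain ⟨p, h₁, h₂⟩ := ih
      refine ⟨p.bit0, ?_, ?_⟩
      · have h₃ := congrArg (fun n : Num => (n : ℕ)) h₁
        simp only [Num.to_of_nat, Num.cast_pos] at h₃
        rw [← Num.to_nat_inj, Num.to_of_nat, Num.cast_pos, PosNum.cast_bit0, ← h₃, pow_succ, mul_two]
      · rw [Computability.encodePosNum, h₂]
        rfl
  obtain ⟨p, h₁, h₂⟩ := h k
  rw [Computability.encodeNat, h₁, ← h₂]
  rfl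

/-- Powers of two with polynomial positive exponents are computable in polynomial time. -/
theorem inFP_two_pow (F : FinTM2) (N : NTM) (E : Polynomial ℕ) (hE : ∀ n, 1 ≤ E.eval n) :
    InFP (Computability.encodingList Bool) fun x => 2 ^ (E.eval x.length - 1) := by
  obtain ⟨P, T, h⟩ := exists_polynomial_program (F := F) (N := N) E
  refine Sem.inFP (X := Store F N) (enc := enc) (P := .seq P (.seq (.basic (putC .clk true))
    (.seq (moveP .val .clk) (drain .inp (.basic .halt)))))
    _ (.inr (.inr (.inl .inp))) (.inr (.inr (.inl .clk))) (Store.base F N true).enc.1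
    (Equiv.refl Bool) (Equiv.refl Bool) (T + (1 + ((3 * E + 2) + (3 * .X + 2)))) fun x => ?_
  set o₀ : Own → List Bool := Function.update (fun _ => []) .inp x with ho₀
  -- Read as an integer, the first `false` is the sign bit, and the remaining `E - 1` zeros followed
  -- by `true` are the binary expansion of `2^(E - 1)`. This is where `E` must be positive.
  set b := List.replicate (E.eval x.length) false ++ [true] with hb
  refine ⟨(Store.base F N true).on o₀ none,
    (Store.base F N true).on (Function.update (fun _ => []) .clk b) none, ?_, ?_, ?_⟩
  · have s₁ := h (Store.base F N true) o₀ none (by simp [ho₀]) (by simp [ho₀]) (by simp [ho₀])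
    have s₂ := sem_put .clk true (Store.base F N true)
      (Function.update o₀ .val (List.replicate (E.eval x.length) false)) none
    have s₃ := sem_moveP (F := F) (N := N) (k := .val) (k' := .clk) (by decide) (Store.base F N true)
      (Function.update (Function.update o₀ .val (List.replicate (E.eval x.length) false)) .clk [true])
      none
    -- The input is erased, because a halting configuration may have no nonempty stack besides the
    -- output stack.
    have s₄ := sem_drain_single (F := F) (N := N) (k := .inp) (body := .basic .halt) (t := 1)
      (W := fun _ : Unit => Store.base F N true)
      (O := fun l _ => Function.update (Function.update (fun _ => []) .clk b) .inp l)
      (next := fun _ _ => ()) (fun l a => by simp)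
      (fun b' l a => ⟨some (.inl b'), .basic (by
        rw [Function.update_idem]
        rfl)⟩) x () none
    have e : (o₀ .inp) = x := by simp [ho₀]
    rw [e] at s₁
    have e₁ : Function.update (Function.update (fun _ => []) Own.clk b) .inp [] =
        Function.update (fun _ => []) Own.clk b := by
      funext j
      cases j <;> simp
    rw [e₁] at s₄
    have s₂' := sem_congr s₂ (o₁ := Function.update o₀ .val (List.replicate (E.eval x.length) false))
      (o₁' := Function.update (Function.update o₀ .val (List.replicate (E.eval x.length) false))
        .clk [true]) rfl (by funext j; cases j <;> simp [ho₀]) le_rfl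
    have s₃' := sem_congr s₃ (o₁' := Function.update (Function.update (fun _ => []) .clk b) .inp x)
      rfl (by funext j; cases j <;> simp [ho₀, hb]) le_rfl
    refine (s₁.seq_left (s₂'.seq_left (s₃'.seq_left s₄))).mono ?_
    simp only [ne_eq, reduceCtorEq, not_false_eq_true, Function.update_of_ne, Function.update_self,
      List.length_replicate]
    simp [Computability.encodingList]
  · rw [enc_base_on]
    simp [Computability.encodingList]
  · rw [enc_base_on, encode_int, ← Nat.cast_two, ← Nat.cast_pow, Int.natAbs_natCast,
      encodeNat_two_pow, hb]
    obtain ⟨k, hk⟩ := Nat.exists_eq_add_of_le' (hE x.length)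
    have h₁ : ¬ (2 : ℤ) ^ k < 0 := not_lt.2 (by positivity)
    rw [hk, List.replicate_succ]
    simp [h₁]

/-- A path accepts iff it ends with sign plus, and the target is half the number of all paths.
Positivity of `r` makes the exponent of the total positive, so that the half is again a power of
two. -/
theorem indexedCeqP_subset (r : Polynomial ℕ) (hr : ∀ n, 1 ≤ r.eval n) :
    IndexedCeqP (fun n => r.eval n) ⊆ CeqP := by
  rintro A ⟨N, ⟨p, hp⟩, f, ⟨h⟩, hA⟩
  -- The clock `p + 1` exceeds the length of every path by at least one, which yields the strict
  -- bound `acc < 2^m`.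
  obtain ⟨P, T, hP⟩ := exists_sem_product N (p + 1) r h
  refine ⟨P.ntm (.inr (.inr (.inl .inp))) (Store.base h.tm N true).enc.1 (Equiv.refl Bool)
    (fun v => v.sign), ⟨T, fun x w hw => ?_⟩, fun x => 2 ^ ((((p + 1) + 1) * r).eval x.length - 1),
    inFP_two_pow h.tm N _ (fun n => ?_), fun x => ?_⟩
  · obtain ⟨O, h₁, -⟩ := hP x
    exact (h₁.acc_eq (.inr (.inr (.inl .inp))) (Store.base h.tm N true).enc.1 (Equiv.refl Bool)
      (fun v => v.sign) (a := x) (by rw [enc_base_on]; simp)).2 w hw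
  · have := hr n
    rw [Polynomial.eval_mul]
    exact Nat.mul_pos (by simp) this
  · obtain ⟨O, h₁, h₂⟩ := hP x
    have h₃ := (h₁.acc_eq (.inr (.inr (.inl .inp))) (Store.base h.tm N true).enc.1 (Equiv.refl Bool)
      (fun v => v.sign) (a := x) (by rw [enc_base_on]; simp)).1
    rw [h₃, hA]
    obtain ⟨h₄, h₅⟩ := acc_eq_card_paths (N := N) (m := (p + 1).eval x.length) (x := x) fun w hw => by
      have := hp x w hw
      simp
      omega
    have h₆ : acceptCount N ((p + 1).eval x.length) x = N.acc x := h₄.symm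
    rw [h₆] at h₂
    change _ ↔ (((O.filter fun y => y.sign = true).card : ℕ) : ℤ) = _
    have e : (2 : ℤ) ^ (((p + 1).eval x.length + 1) * r.eval x.length) =
        2 * 2 ^ ((((p + 1) + 1) * r).eval x.length - 1) := by
      have : 1 ≤ ((p + 1).eval x.length + 1) * r.eval x.length :=
        Nat.mul_pos (Nat.succ_pos _) (hr x.length)
      rw [← pow_succ', Polynomial.eval_mul, Polynomial.eval_add (p := p + 1), Polynomial.eval_one,
        Nat.sub_add_cancel this]
    rw [e] at h₂
    have h₇ : (((O.filter fun y => y.sign = true).card : ℕ) : ℤ) =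
        2 ^ ((((p + 1) + 1) * r).eval x.length - 1) ↔ ∏ j ∈ Finset.range (r.eval x.length),
          (2 * ((N.acc x : ℤ) - threshold ((p + 1).eval x.length) (f (x, j + 1)))) = 0 := by
      constructor <;> intro h <;> linarith
    rw [h₇, Finset.prod_eq_zero_iff]
    -- A factor vanishes iff the true value is hit, even though the factor contains only the
    -- truncated value.
    have h₈ : ∀ z, (N.acc x : ℤ) = z ↔
        2 * ((N.acc x : ℤ) - threshold ((p + 1).eval x.length) z) = 0 := fun z => by
      rw [← eq_threshold_iff h₅]
      omega
    simp only [← h₈, Finset.mem_Icc, Finset.mem_range]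
    constructor
    · rintro ⟨i, hi, h₉⟩
      refine ⟨i - 1, by omega, ?_⟩
      rwa [Nat.sub_add_cancel hi.1]
    · rintro ⟨j, hj, h₉⟩
      exact ⟨j + 1, by omega, h₉⟩

/-! ### Functions that ignore the index -/

/-- Pop a symbol of an encoded pair into the buffer. -/
def popPairC : Code F N :=
  .pop (.inr (.inr (.inr ()))) (fun v b => { v with buf := b }) .halt

/-- Push the bit in the buffer to the input stack if it belongs to the first component. -/
def filterC : Code F N :=
  .branch (fun v => v.buf.elim false Sum.isLeft) (pushC .inp) .halt

/-- Extract the first component of an encoded pair. -/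
def firstP : Program F N :=
  .seq (.basic popPairC) (.loop (fun v => v.buf.isSome) (.seq (.basic filterC) (.basic popPairC)))

/-- Replace the encoded pair. -/
def Store.setP (s : Store F N) (a : List (Bool ⊕ Bool)) : Store F N := { s with p := a }

theorem sem_popPair (s : Store F N) (a : List (Bool ⊕ Bool)) (o c) :
    Sem enc (.basic popPairC) ((s.setP a).on o c) 1 {(s.setP a.tail).on o a.head?} :=
  .basic (Prod.ext rfl (((s.setP a).on o c).update_enc_p _))

theorem sem_firstP (s : Store F N) (a : List (Bool ⊕ Bool)) (o : Own → List Bool) (c) :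
    Sem enc firstP ((s.setP a).on o c) (3 * a.length + 2)
      {(s.setP []).on (Function.update o .inp ((a.filterMap Sum.getLeft?).reverse ++ o .inp)) none} := by
  refine ((sem_popPair s a o c).seq_left (t' := 3 * a.length + 1) ?_).mono (by omega)
  induction a generalizing o with
  | nil =>
    rw [show Function.update o .inp ((([] : List (Bool ⊕ Bool)).filterMap Sum.getLeft?).reverse ++
      o .inp) = o by simp]
    exact (Sem.done rfl).mono (by simp)
  | cons b a ih =>
    cases b with
    | inl b =>
      have h₁ : Sem enc (.basic filterC) ((s.setP a).on o (some (.inl b))) 1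
          {(s.setP a).on (Function.update o .inp (b :: o .inp)) (some (.inl b))} :=
        .basic (Store.exec_pushC (s.setP a) o (some (.inl b)) .inp)
      refine (Sem.again_left rfl (h₁.seq_left (sem_popPair s a _ _)) (ih _)).mono (t' := 3 * (a.length + 1) + 1) (by omega)
        |> fun h => ?_
      simpa using h
    | inr b =>
      have h₁ : Sem enc (.basic filterC) ((s.setP a).on o (some (.inr b))) 1
          {(s.setP a).on o (some (.inr b))} := .basic rfl
      refine (Sem.again_left rfl (h₁.seq_left (sem_popPair s a _ _)) (ih _)).mono (t' := 3 * (a.length + 1) + 1) (by omega)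
        |> fun h => ?_
      rw [show (Sum.inr b :: a).filterMap Sum.getLeft? = a.filterMap Sum.getLeft? from rfl]
      simpa using h

/-- The second component of the pair is discarded before the machine for `f` runs. The machine `N`
plays no part in the computation; it only completes the type of the store. -/
theorem InFP.comp_fst {f : List Bool → ℤ} (N : NTM) (h : InFP (Computability.encodingList Bool) f) :
    InFP encodingPair fun y => f y.1 := by
  obtain ⟨h⟩ := h
  refine Sem.inFP (X := Store h.tm N) (enc := enc) (P := .seq firstP (.seq
    (drain .inp (.basic (pushF h.inputAlphabet.symm))) (.seq runP
      -- A deterministic machine must halt in its initial internal state, so the recorded label is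
      -- set back to the start label.
      (.basic (.load (fun v => { v with fl := some h.tm.main }) .halt)))))
    _ (.inr (.inr (.inr ()))) (.inl h.tm.k₁) (Store.base h.tm N true).enc.1
    (Equiv.refl (Bool ⊕ Bool)) h.outputAlphabet
    ((3 * .X + 2) + ((3 * .X + 2) + (2 * h.time + 1 + 1))) fun ⟨x, i⟩ => ?_
  refine ⟨(Store.base h.tm N true).setP (encodingPair.encode (x, i)),
    { Store.base h.tm N true with
      f := ⟨some h.tm.main, h.tm.initialState,
        stacksAt h.tm.k₁ ((encodingInt.encode (f x)).map h.outputAlphabet.symm)⟩ }, ?_, ?_, ?_⟩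
  · have s₁ := sem_firstP (Store.base h.tm N true) (encodingPair.encode (x, i)) (fun _ => []) none
    have e₁ : (encodingPair.encode (x, i)).filterMap Sum.getLeft? = x := by
      rw [encode_pair, List.filterMap_append, List.filterMap_map, List.filterMap_map]
      simp [Function.comp_def]
    rw [e₁, List.append_nil] at s₁
    -- Extraction has left the word reversed on `inp`; draining it onto the input stack restores the
    -- order.
    have s₂ := sem_drain_single (F := h.tm) (N := N) (k := .inp)
      (body := .basic (pushF h.inputAlphabet.symm)) (t := 1)
      (W := fun a => (Store.base h.tm N true).setInF a)
      (O := fun l _ => Function.update (fun _ => []) .inp l)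
      (next := fun b a => h.inputAlphabet.symm b :: a) (fun l a => by simp)
      (fun b l a => ⟨some (.inl b), by
        rw [Function.update_idem]
        exact .basic (Store.exec_pushF _ _ (some (.inl b)) h.inputAlphabet.symm a)⟩)
      x.reverse [] none
    rw [List.foldl_reverse, foldr_cons_map, List.append_nil, setInF_base, setF_base_input,
      Function.update_eq_self_iff.2 rfl] at s₂
    have s₃ := sem_runP_of_outputs (h.outputsFun x) (Store.base h.tm N true)
    rw [haltList_eq] at s₃
    refine (s₁.seq_left (s₂.seq_left (s₃.seq_left (.basic rfl)))).mono ?_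
    have h₁ : x.length ≤ (encodingPair.encode (x, i)).length := by simp [encode_pair]
    have h₂ := Polynomial.eval_nat_mono h.time h₁
    have h₃ : ((Computability.encodingList Bool).encode x).length = x.length := rfl
    simp [h₃]
    omega
  · refine Prod.ext rfl (((Store.base h.tm N true).update_enc_p _).symm.trans ?_)
    rw [enc_base, stacksAt]
    simp
  · refine Prod.ext rfl (((Store.base h.tm N true).update_enc_f h.tm.k₁ _).symm.trans ?_)
    rw [enc_base, stacksAt]

theorem ceqP_subset : CeqP ⊆ PolyCeqP := by
  rintro A ⟨N, hN, f, hf, hA⟩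
  -- Any exponent would do: the index range only has to be nonempty, and for `c = 1` it has `n + 1`
  -- elements.
  refine Set.mem_iUnion.2 ⟨1, N, hN, fun y => f y.1, hf.comp_fst N, fun x => (hA x).trans ?_⟩
  constructor
  · exact fun h => ⟨1, by simp, h⟩
  · rintro ⟨_, _, h⟩
    exact h

theorem polyCeqP_subset : PolyCeqP ⊆ CeqP := by
  refine Set.iUnion_subset fun c => ?_
  have := indexedCeqP_subset (.X ^ (c : ℕ) + .C (c : ℕ)) fun n => by
    have := c.pos
    simp
    omega
  simpa using this

end ExactCounting

theorem mainTheorem8 : ExactCounting.PolyCeqP = ExactCounting.CeqP :=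
  ExactCounting.polyCeqP_subset.antisymm ExactCounting.ceqP_subset
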